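/- **Definitions.** *Matchings.* A matching of length $n$ is a partition of $\{1,\dots,2n\}$ into $n$ pairs (arcs) $[a,b]$, $a<b$, with opener $a$ and closer $b$. It is a *Stoimenow matching* if it has no two nested arcs $a<c<d<b$ (with $[a,b],[c,d]$ arcs) such that $c=a+1$ or $b=d+1$. It contains a pattern (a smaller matching) if deleting some arcs and relabelling the remaining points in order gives that pattern; otherwise it avoids it. Let $P_1=\{[1,3],[2,7],[4,5],[6,8]\}$ and $P_2=\{[1,3],[2,5],[4,7],[6,8]\}$, and let $\mathcal M(P_i)$ be the set of Stoimenow matchings of all lengths $n\ge 0$ that avoid $P_i$. A crossing of $M$ is a nonempty set of arcs with $a_1<\dots<a_k<b_1<\dots<b_k$. $\mathsf{fcr}(M)$ is the size of the first maximal crossing, i.e. of the inclusion-maximal crossing that contains the arc starting at $1$ (and $0$ for the empty matching). $\mathsf{bl}(M)$ is the number of irreducible blocks, i.e. the number of $i\in\{1,\dots,n\}$ such that $\{1,\dots,2i\}$ contains as many openers as closers. *Posets.* $\mathcal P(\mathbf{3+1})$ and $\mathcal P(\mathbf N)$ are the sets of isomorphism classes of finite posets without an induced subposet $\mathbf{2+2}$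 (two disjoint 2-element chains) and without an induced $\mathbf{3+1}$ (disjoint union of a 3-element chain and a point), respectively $\mathbf N$ (elements $a,b,c,d$ with relations $a<c$, $a<d$, $b<d$). For a poset $P$, $\mathsf{min}(P)$ is the number of minimal elements, $\mathsf{smc}(P)$ is the size of the shortest maximal chain, and $\mathsf{ssd}(P)$ is the number of summands in the decomposition of $P$ as an ordinal sum of irreducible posets (nonempty posets that are not ordinal sums of two nonempty posets). *Ascent sequences.* $\mathcal A(101)$ is the set of sequences $(\alpha_1,\dots,\alpha_n)$, $n\ge0$, of nonnegative integers with $\alpha_1=0$ and $\alpha_i\le 1+\#\{j<i-1:\alpha_j<\alpha_{j+1}\}$ for $2\le i\le n$, having no subsequence order-isomorphic to $101$. $\mathsf{zero}(\alpha)$ is the number of zeros and $\mathsf{rmin}(\alpha)=\#\{i:\alpha_i<\alpha_j\text{ for all }j>i\}$. *Fishburn permutations.* $\mathcal F(3142)$ is the set of permutations $\pi$ of $\{1,\dots,n\}$, $n\ge0$, for which there are no $i,j$ with $j>i+1$ and $\pi_j+1=\pi_i<\pi_{i+1}$, and which have no subsequence order-isomorphic to $3142$. $\mathsf{idr}(\pi)$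 is the length of the initial descending run and $\mathsf{lmax}(\pi)=\#\{i:\pi_i>\pi_j\text{ for all }j<i\}$. The size $|\cdot|$ of an object is its $n$ (number of arcs, elements, or entries). **Theorem.** As formal power series in $t$ with coefficients in $\mathbb Q[y,z]$, $$\begin{aligned} &\sum_{M\in\mathcal M(P_1)}y^{\mathsf{fcr}(M)}z^{\mathsf{bl}(M)}t^{|M|} =\sum_{M\in\mathcal M(P_2)}y^{\mathsf{fcr}(M)}z^{\mathsf{bl}(M)}t^{|M|} =\sum_{P\in\mathcal P(\mathbf{3+1})}y^{\mathsf{min}(P)}z^{\mathsf{ssd}(P)}t^{|P|}\\ &=\sum_{P\in\mathcal P(\mathbf N)}y^{\mathsf{min}(P)}z^{\mathsf{smc}(P)}t^{|P|} =\sum_{\alpha\in\mathcal A(101)}y^{\mathsf{zero}(\alpha)}z^{\mathsf{rmin}(\alpha)}t^{|\alpha|} =\sum_{\pi\in\mathcal F(3142)}y^{\mathsf{idr}(\pi)}z^{\mathsf{lmax}(\pi)}t^{|\pi|}\\ &=1+\frac{4t^2\,yzt}{\bigl(2t-yt(1-\sqrt{1-4t})\bigr)\bigl(2t-zt(1-\sqrt{1-4t})\bigr)}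 =1+yzt\,C(y,t)\,C(z,t), \end{aligned}$$ where $C(x,t)=\dfrac1{1-xt\,C(t)}$, $C(t)=\sum_{n\ge0}\frac1{n+1}\binom{2n}{n}t^n$. The fraction is understood in the field of fractions of $\mathbb Q[y,z][[t]]$, where its denominator is nonzero. The series $C(x,t)$ is the generating function of the ballot numbers $T(n,k)=\frac{n-k+1}{n+1}\binom{n+k}{k}$, $0\le k\le n$: $$C(x,t)=1+\sum_{n\ge0}\sum_{k=0}^{n}T(n,k)\,x^{\,n+1-k}\,t^{\,n+1}.$$ In particular, the joint distribution of $(\mathsf{fcr},\mathsf{bl})$ over $\mathcal M(P_1)$, and over $\mathcal M(P_2)$, is symmetric: the generating function is invariant under interchanging $y$ and $z$. -/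

import Mathlib

namespace Fishburn

/-! ### Matchings -/

/-- A matching on `2 * n` points in a line (a partition of the points into `n` pairs), given by the
map that sends each point to the other point of its pair. -/
@[ext]
structure Matching (n : ℕ) where
  partner : Fin (2 * n) → Fin (2 * n)
  partner_partner : ∀ i, partner (partner i) = i
  partner_ne : ∀ i, partner i ≠ i

namespace Matching

variable {n : ℕ}

/-- `[a, b]` is an arc, with opener `a` and closer `b`. -/
def IsArc (M : Matching n) (a b : Fin (2 * n)) : Prop := a < b ∧ M.partner a = b

def IsOpener (M : Matching n) (a : Fin (2 * n)) : Prop := a < M.partner a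

def IsCloser (M : Matching n) (a : Fin (2 * n)) : Prop := M.partner a < a

/-- Neither two nested arcs with adjacent openers (Type I) nor two nested arcs with adjacent
closers (Type II). -/
def IsStoimenow (M : Matching n) : Prop :=
  (¬ ∃ i j k l : Fin (2 * n),
      M.IsArc i l ∧ M.IsArc j k ∧ (j : ℕ) = i + 1 ∧ k < l) ∧
  (¬ ∃ k l i j : Fin (2 * n),
      M.IsArc k j ∧ M.IsArc l i ∧ (j : ℕ) = i + 1 ∧ k < l)

/-- Some submatching of `M`, obtained by removing arcs, is isomorphic to the pattern `P`. -/
def Contains {k : ℕ} (M : Matching n) (P : Matching k) : Prop :=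
  ∃ f : Fin (2 * k) ↪o Fin (2 * n), ∀ i, M.partner (f i) = f (P.partner i)

/-- A `k`-crossing `a₁ < ⋯ < a_k < b₁ < ⋯ < b_k` with `k ≥ 1`, given by the set of the openers of
its arcs. -/
def IsCrossing (M : Matching n) (S : Finset (Fin (2 * n))) : Prop :=
  S.Nonempty ∧ (∀ a ∈ S, M.IsOpener a) ∧
    ∀ a ∈ S, ∀ b ∈ S, a < b → b < M.partner a ∧ M.partner a < M.partner b

/-- A crossing that is not contained in a larger one. -/
def IsMaximalCrossing (M : Matching n) (S : Finset (Fin (2 * n))) : Prop :=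
  Maximal M.IsCrossing S

/-- The size of the first maximal crossing, that is, of the maximal crossing that contains the
first arc (in a Stoimenow matching with at least one arc there is exactly one); it is `0` for the
empty matching. -/
noncomputable def fcr (M : Matching n) : ℕ :=
  sSup {k | ∃ S, M.IsMaximalCrossing S ∧ (∃ a ∈ S, (a : ℕ) = 0) ∧ S.card = k}

/-- The first `2 * i` points contain as many openers as closers. -/
def IsBalancedAt (M : Matching n) (i : ℕ) : Prop :=
  Nat.card {a : Fin (2 * n) // (a : ℕ) < 2 * i ∧ M.IsOpener a} =
    Nat.card {a : Fin (2 * n) // (a : ℕ) < 2 * i ∧ M.IsCloser a}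

/-- The number of irreducible blocks: the blocks end exactly at the points `2 * i`, `1 ≤ i ≤ n`,
such that the first `2 * i` points are balanced. -/
noncomputable def bl (M : Matching n) : ℕ :=
  Set.ncard {i : ℕ | 1 ≤ i ∧ i ≤ n ∧ M.IsBalancedAt i}

/-- On the points `0, …, 7`, the arcs `[0,2], [1,6], [3,4], [5,7]`. -/
def patternOne : Matching 4 where
  partner := ![2, 6, 0, 4, 3, 7, 1, 5]
  partner_partner := by decide
  partner_ne := by decide

/-- On the points `0, …, 7`, the arcs `[0,2], [1,4], [3,6], [5,7]`. -/
def patternTwo : Matching 4 where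
  partner := ![2, 4, 0, 6, 1, 7, 3, 5]
  partner_partner := by decide
  partner_ne := by decide

theorem partner_injective : Function.Injective (partner : Matching n → _) :=
  fun _ _ h => Matching.ext h

instance : Finite (Matching n) := Finite.of_injective _ partner_injective

end Matching

/-- Stoimenow matchings with `n` arcs that avoid the pattern `P`. -/
def StoimenowAvoiding {k : ℕ} (P : Matching k) (n : ℕ) : Type :=
  {M : Matching n // M.IsStoimenow ∧ ¬ M.Contains P}

instance {k : ℕ} (P : Matching k) (n : ℕ) : Finite (StoimenowAvoiding P n) :=
  inferInstanceAs (Finite (Subtype _))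

/-! ### Posets -/

section Poset

variable (α : Type) [PartialOrder α]

/-- The number of minimal elements. -/
noncomputable def minCount : ℕ := Nat.card {x : α // IsMin x}

/-- The size of the shortest maximal chain. -/
noncomputable def smc : ℕ :=
  sInf {k | ∃ s : Set α, IsMaxChain (· ≤ ·) s ∧ s.ncard = k}

/-- A nonempty poset that is not the ordinal sum of two nonempty posets. -/
def IsIrreducible : Prop :=
  Nonempty α ∧ ¬ ∃ D : Set α, D.Nonempty ∧ Dᶜ.Nonempty ∧ ∀ x ∈ D, ∀ y ∈ Dᶜ, x < y

variable {α} in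
/-- The fibres of `f` over `0, 1, …, k - 1` are the summands of a decomposition of the poset as an
ordinal sum of `k` irreducible posets. -/
def IsOrdinalSumDecomposition {k : ℕ} (f : α → Fin k) : Prop :=
  (∀ x y, f x < f y → x < y) ∧ ∀ i, IsIrreducible {x : α // f x = i}

/-- The number of subposets in the ordinal sum decomposition into irreducible posets. -/
noncomputable def ssd : ℕ :=
  sSup {k | ∃ f : α → Fin k, IsOrdinalSumDecomposition f}

/-- No induced subposet is isomorphic to `Q`. -/
def IsFreeOf (Q : Type) [PartialOrder Q] : Prop := IsEmpty (Q ↪o α)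

end Poset

/-- The disjoint union of two 2-element chains. -/
abbrev TwoPlusTwo : Type := Fin 2 ⊕ Fin 2

/-- The disjoint union of a 3-element chain and a 1-element chain. -/
abbrev ThreePlusOne : Type := Fin 3 ⊕ Fin 1

/-- The poset on `{a, b, c, d}` with the relations `a < c`, `a < d` and `b < d`. -/
inductive PosetN : Type
  | a | b | c | d

namespace PosetN

/-- The order relation: the reflexive closure of `a < c`, `a < d`, `b < d`. -/
inductive Rel : PosetN → PosetN → Prop
  | refl (x : PosetN) : Rel x x
  | ac : Rel a c
  | ad : Rel a d
  | bd : Rel b d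

instance : PartialOrder PosetN where
  le := Rel
  le_refl := Rel.refl
  le_trans := by
    intro x y z h₁ h₂
    cases h₁ <;> cases h₂ <;> constructor
  le_antisymm := by
    intro x y h₁ h₂
    cases h₁ <;> cases h₂ <;> rfl

end PosetN

section Invariance

variable {α β : Type} [PartialOrder α] [PartialOrder β]

theorem minCount_congr (e : α ≃o β) : minCount α = minCount β :=
  Nat.card_congr (e.toEquiv.subtypeEquiv fun x => (OrderIso.isMin_apply e (x := x)).symm)

theorem smc_congr (e : α ≃o β) : smc α = smc β := by
  have key : ∀ {γ δ : Type} [PartialOrder γ] [PartialOrder δ] (e : γ ≃o δ) (k : ℕ),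
      (∃ s : Set γ, IsMaxChain (· ≤ ·) s ∧ s.ncard = k) →
        ∃ s : Set δ, IsMaxChain (· ≤ ·) s ∧ s.ncard = k := by
    rintro γ δ _ _ e k ⟨s, hs, hk⟩
    exact ⟨e '' s, hs.image e, by rw [Set.ncard_image_of_injective _ e.injective, hk]⟩
  unfold smc
  congr 1
  ext k
  exact ⟨key e k, key e.symm k⟩

theorem IsIrreducible.congr (e : α ≃o β) (h : IsIrreducible α) : IsIrreducible β := by
  obtain ⟨⟨x⟩, h⟩ := h
  refine ⟨⟨e x⟩, ?_⟩
  rintro ⟨D, ⟨u, hu⟩, ⟨v, hv⟩, hD⟩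
  refine h ⟨e ⁻¹' D, ⟨e.symm u, by simpa using hu⟩, ⟨e.symm v, by simpa using hv⟩, ?_⟩
  intro p hp q hq
  exact e.lt_iff_lt.1 (hD _ hp _ hq)

theorem ssd_congr (e : α ≃o β) : ssd α = ssd β := by
  have key : ∀ {γ δ : Type} [PartialOrder γ] [PartialOrder δ] (e : γ ≃o δ) (k : ℕ),
      (∃ f : γ → Fin k, IsOrdinalSumDecomposition f) →
        ∃ f : δ → Fin k, IsOrdinalSumDecomposition f := by
    rintro γ δ _ _ e k ⟨f, hf, hi⟩
    refine ⟨f ∘ e.symm, fun x y h => e.symm.lt_iff_lt.1 (hf _ _ h), fun i => ?_⟩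
    refine (hi i).congr
      { toEquiv := e.toEquiv.subtypeEquiv fun x => by simp
        map_rel_iff' := ?_ }
    intro p q
    exact e.le_iff_le
  unfold ssd
  congr 1
  ext k
  exact ⟨key e k, key e.symm k⟩

theorem isFreeOf_congr (Q : Type) [PartialOrder Q] (e : α ≃o β) :
    IsFreeOf α Q = IsFreeOf β Q :=
  propext ⟨fun h => ⟨fun f => h.false (f.trans e.symm.toOrderEmbedding)⟩,
    fun h => ⟨fun f => h.false (f.trans e.toOrderEmbedding)⟩⟩

end Invariance

/-- Two partial orders on `Fin n` are equivalent if they are isomorphic as posets. -/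
instance posetSetoid (n : ℕ) : Setoid (PartialOrder (Fin n)) where
  r P Q := Nonempty (@OrderIso (Fin n) (Fin n) P.toLE Q.toLE)
  iseqv :=
    { refl := fun P => ⟨@OrderIso.refl (Fin n) P.toLE⟩
      symm := fun {P Q} h => h.map (@OrderIso.symm (Fin n) (Fin n) P.toLE Q.toLE)
      trans := fun {P Q R} h₁ h₂ =>
        h₁.elim fun e₁ => h₂.elim fun e₂ =>
          ⟨@OrderIso.trans (Fin n) (Fin n) (Fin n) P.toLE Q.toLE R.toLE e₁ e₂⟩ }

/-- (Unlabelled) posets with `n` elements, that is, posets up to isomorphism. -/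
def PosetClass (n : ℕ) : Type := Quotient (posetSetoid n)

namespace PosetClass

variable {n : ℕ}

noncomputable def minCount (p : PosetClass n) : ℕ :=
  Quotient.lift (fun P : PartialOrder (Fin n) => @Fishburn.minCount (Fin n) P)
    (fun P Q (h : Nonempty (@OrderIso (Fin n) (Fin n) P.toLE Q.toLE)) =>
      h.elim fun e => @minCount_congr (Fin n) (Fin n) P Q e) p

noncomputable def smc (p : PosetClass n) : ℕ :=
  Quotient.lift (fun P : PartialOrder (Fin n) => @Fishburn.smc (Fin n) P)
    (fun P Q (h : Nonempty (@OrderIso (Fin n) (Fin n) P.toLE Q.toLE)) =>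
      h.elim fun e => @smc_congr (Fin n) (Fin n) P Q e) p

noncomputable def ssd (p : PosetClass n) : ℕ :=
  Quotient.lift (fun P : PartialOrder (Fin n) => @Fishburn.ssd (Fin n) P)
    (fun P Q (h : Nonempty (@OrderIso (Fin n) (Fin n) P.toLE Q.toLE)) =>
      h.elim fun e => @ssd_congr (Fin n) (Fin n) P Q e) p

def IsFreeOf (p : PosetClass n) (Q : Type) [PartialOrder Q] : Prop :=
  Quotient.lift (fun P : PartialOrder (Fin n) => @Fishburn.IsFreeOf (Fin n) P Q _)
    (fun P P' (h : Nonempty (@OrderIso (Fin n) (Fin n) P.toLE P'.toLE)) =>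
      h.elim fun e => @isFreeOf_congr (Fin n) (Fin n) P P' Q _ e) p

instance : Finite (PartialOrder (Fin n)) :=
  Finite.of_injective (fun P : PartialOrder (Fin n) => P.le) fun _ _ h =>
    PartialOrder.ext fun x y => iff_of_eq (congrFun (congrFun h x) y)

instance : Finite (PosetClass n) := inferInstanceAs (Finite (Quotient _))

end PosetClass

/-- **(2+2)**-free posets with `n` elements, up to isomorphism, that are also `Q`-free. -/
def PosetAvoiding (Q : Type) [PartialOrder Q] (n : ℕ) : Type :=
  {p : PosetClass n // p.IsFreeOf TwoPlusTwo ∧ p.IsFreeOf Q}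

instance (Q : Type) [PartialOrder Q] (n : ℕ) : Finite (PosetAvoiding Q n) :=
  inferInstanceAs (Finite (Subtype _))

/-! ### Words: ascent sequences and permutations -/

section Word

variable {β : Type} [LinearOrder β] {n : ℕ}

/-- Some subsequence of the word `w` is order-isomorphic to the pattern `p`. -/
def ContainsPattern {m : ℕ} (w : Fin n → β) (p : Fin m → ℕ) : Prop :=
  ∃ f : Fin m ↪o Fin n, ∀ a b, p a < p b ↔ w (f a) < w (f b)

/-- The number of left-to-right maxima. -/
noncomputable def lmax (w : Fin n → β) : ℕ := Nat.card {i : Fin n // ∀ j < i, w j < w i}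

/-- The number of right-to-left minima. -/
noncomputable def rmin (w : Fin n → β) : ℕ := Nat.card {i : Fin n // ∀ j > i, w i < w j}

/-- The length of the initial descending run: the number of positions such that the word is
strictly decreasing up to this position. -/
noncomputable def idr (w : Fin n → β) : ℕ := Nat.card {i : Fin n // StrictAntiOn w (Set.Iic i)}

end Word

/-- The number of zeros. -/
noncomputable def zeroCount {n : ℕ} (w : Fin n → ℕ) : ℕ := Nat.card {i : Fin n // w i = 0}

/-- The number of ascents of the part of the word that strictly precedes position `i`. -/
noncomputable def ascBefore {n : ℕ} (w : Fin n → ℕ) (i : Fin n) : ℕ :=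
  Nat.card {k : Fin n // k < i ∧ ∃ j : Fin n, (k : ℕ) = j + 1 ∧ w j < w k}

/-- The first entry is `0`, and every later entry is at most one more than the number of ascents
before it. -/
def IsAscentSequence {n : ℕ} (w : Fin n → ℕ) : Prop :=
  ∀ i : Fin n, ((i : ℕ) = 0 → w i = 0) ∧ ((i : ℕ) ≠ 0 → w i ≤ 1 + ascBefore w i)

/-- Ascent sequences of length `n` that avoid the pattern `p`. -/
def AscentAvoiding {m : ℕ} (p : Fin m → ℕ) (n : ℕ) : Type :=
  {w : Fin n → ℕ // IsAscentSequence w ∧ ¬ ContainsPattern w p}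

instance {m : ℕ} (p : Fin m → ℕ) (n : ℕ) : Finite (AscentAvoiding p n) := by
  refine Set.Finite.subset (Set.finite_Iic (fun _ : Fin n => 1 + n)) ?_
  intro w hw i
  by_cases h : (i : ℕ) = 0
  · simp [(hw.1 i).1 h]
  · refine ((hw.1 i).2 h).trans (Nat.add_le_add_left ?_ 1)
    refine (Finite.card_subtype_le _).trans ?_
    simp

/-- No occurrence of the Fishburn pattern, that is, no `i` and `j > i + 1` such that
`π j + 1 = π i < π (i + 1)`. -/
def IsFishburn {n : ℕ} (π : Equiv.Perm (Fin n)) : Prop :=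
  ¬ ∃ i i' j : Fin n, (i' : ℕ) = i + 1 ∧ i' < j ∧ (π j : ℕ) + 1 = π i ∧ π i < π i'

/-- Fishburn permutations of length `n` that avoid the classical pattern `p`. -/
def FishburnAvoiding {m : ℕ} (p : Fin m → ℕ) (n : ℕ) : Type :=
  {π : Equiv.Perm (Fin n) // IsFishburn π ∧ ¬ ContainsPattern π p}

instance {m : ℕ} (p : Fin m → ℕ) (n : ℕ) : Finite (FishburnAvoiding p n) :=
  inferInstanceAs (Finite (Subtype _))

/-! ### Generating functions -/

/-- The polynomial ring `ℚ[y, z]`. -/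
abbrev Coeffs : Type := MvPolynomial (Fin 2) ℚ

/-- The ring `ℚ[y, z]⟦t⟧`. -/
abbrev Series : Type := PowerSeries Coeffs

noncomputable def varY : Coeffs := MvPolynomial.X 0

noncomputable def varZ : Coeffs := MvPolynomial.X 1

/-- `y` as a power series in `t`. -/
noncomputable def serY : Series := PowerSeries.C varY

/-- `z` as a power series in `t`. -/
noncomputable def serZ : Series := PowerSeries.C varZ

/-- `t` as a power series in `t`. -/
noncomputable def serT : Series := PowerSeries.X

/-- The generating function `∑ y ^ f(x) * z ^ g(x) * t ^ |x|` over all `x` in the union of the finite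
sets `T n`, where `|x| = n` for `x` in `T n`. -/
noncomputable def genFun (T : ℕ → Type) [∀ n, Finite (T n)] (f g : ∀ n, T n → ℕ) : Series :=
  PowerSeries.mk fun n =>
    letI := Fintype.ofFinite (T n)
    ∑ x : T n, varY ^ f n x * varZ ^ g n x

/-- The pair `(fcr, bl)` over the Stoimenow matchings that avoid the pattern `P`. -/
noncomputable def genMatching {k : ℕ} (P : Matching k) : Series :=
  genFun (StoimenowAvoiding P) (fun _ M => M.1.fcr) (fun _ M => M.1.bl)

/-- The pair `(min, ssd)` over the **(2+2, 3+1)**-free posets. -/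
noncomputable def genPosetThreePlusOne : Series :=
  genFun (PosetAvoiding ThreePlusOne) (fun _ p => p.1.minCount) (fun _ p => p.1.ssd)

/-- The pair `(min, smc)` over the **(2+2, N)**-free posets. -/
noncomputable def genPosetN : Series :=
  genFun (PosetAvoiding PosetN) (fun _ p => p.1.minCount) (fun _ p => p.1.smc)

/-- The pair `(zero, rmin)` over the ascent sequences that avoid `101`. -/
noncomputable def genAscent : Series :=
  genFun (AscentAvoiding ![1, 0, 1]) (fun _ w => zeroCount w.1) (fun _ w => rmin w.1)

/-- The pair `(idr, lmax)` over the Fishburn permutations that avoid `3142`. -/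
noncomputable def genFishburn : Series :=
  genFun (FishburnAvoiding ![3, 1, 4, 2]) (fun _ π => idr π.1) (fun _ π => lmax π.1)

/-- The generating function `C(t)` of the Catalan numbers. -/
noncomputable def catalanGF : Series :=
  PowerSeries.map (Nat.castRingHom Coeffs) PowerSeries.catalanSeries

/-- `C(x, t) = 1 / (1 - x t C(t))`. -/
noncomputable def ballotGF (x : Coeffs) : Series :=
  PowerSeries.invOfUnit (1 - PowerSeries.C x * PowerSeries.X * catalanGF) 1

theorem ballotGF_spec (x : Coeffs) :
    (1 - PowerSeries.C x * PowerSeries.X * catalanGF) * ballotGF x = 1 :=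
  PowerSeries.mul_invOfUnit _ _ (by simp)

/-- The ballot numbers `(n - k + 1) / (n + 1) * binom (n + k) k`, for `0 ≤ k ≤ n`. -/
def ballotNumber (n k : ℕ) : ℚ := ((n : ℚ) - k + 1) / (n + 1) * (n + k).choose k

/-- The power series `√(1 - 4 t)`, by the binomial series. -/
noncomputable def sqrtSeries : Series :=
  PowerSeries.rescale (-4) (PowerSeries.binomialSeries Coeffs (1 / 2 : ℚ))

theorem sqrtSeries_sq : sqrtSeries ^ 2 = 1 - 4 * PowerSeries.X := by
  rw [sqrtSeries, ← map_pow, sq, ← PowerSeries.binomialSeries_add]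
  have h : (1 / 2 + 1 / 2 : ℚ) = ((1 : ℕ) : ℚ) := by norm_num
  rw [h, PowerSeries.binomialSeries_nat]
  have h4 : (PowerSeries.C (4 : Coeffs) : Series) = 4 := map_ofNat PowerSeries.C 4
  simp [PowerSeries.rescale_X, h4]
  ring

/-- The field of fractions of `ℚ[y, z]⟦t⟧`. -/
abbrev SeriesFrac : Type := FractionRing Series

/-- The inclusion of `ℚ[y, z]⟦t⟧` into its field of fractions. -/
noncomputable def toFrac : Series →+* SeriesFrac := algebraMap Series SeriesFrac

/-- Interchange of `y` and `z`. -/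
noncomputable def swapYZ : Series →+* Series :=
  PowerSeries.map (MvPolynomial.rename (R := ℚ) (Equiv.swap (0 : Fin 2) 1)).toRingHom

end Fishburn

namespace Fishburn

/-! ### Generating functions of Catalan families -/

/-! Every family is encoded by functions on {0, …, n-1}, and the encoded sets are Catalan families
in which the two statistics live on opposite sides of the recursion. In such a family
(`IsCatalanPair`) an object of size n+1 is a pair (A, B) of total size n, with f = f(A) + 1 and g =
g(B) + 1. Hence W(y,z) = 1 + t y z W(y,1) W(1,z). At y = z = 1 this is the Catalan equation; with
one variable at 1 it becomes linear, with solution C(x,t). The product formula and the symmetry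
follow (`IsCatalanPair.genFun_eq`).

For posets, a function with x < e x ≤ n encodes the order "x below y iff e x ≤ y". A poset is
(2+2)-free exactly when its down-sets form a chain, so sorting by size of the down-set produces such
a code. It becomes unique once elements with equal down-sets are sorted by size of the up-set, in
either direction (`exists_codes`, `Codes.eq_of_tieSorted`). Avoiding 3+1 with one direction gives
the monotone functions, that is, Dyck paths (`isMono_iff`); avoiding N with the other direction
gives the noncrossing functions, that is, ordered forests (`isNoncrossing_iff`). Minimal elements
and ordinal cuts become `minC` and `cutC`, and for noncrossing codes the forest roots form a
shortest maximal chain (`Codes.smc_eq`).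

A matching yields a code by counting the openers before each closer. The Stoimenow condition says
that the closers are in canonical order and that ties are sorted increasingly, and the two forbidden
patterns become 3+1 and N (`Matching.Codes.contains_patternOne_iff`,
`Matching.Codes.contains_patternTwo_iff`). For N this tie order is not the noncrossing one; both
codes describe the same posets, and comparing them through the pair (min, ssd) closes the gap
(`genFun_isSortedNFree`).

Fishburn permutations avoiding 3142 are the 231-avoiding permutations, encoded by the position of
the next greater entry, which is a noncrossing function. Ascent sequences avoiding 101 are the
restricted growth functions avoiding 101, and these split at their last zero. -/

/-- The generating function of `a ^ f(x) * b ^ g(x) * t ^ |x|` for given weights `a` and `b`. -/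
noncomputable def weightSeries (T : ℕ → Type) [∀ n, Finite (T n)] (f g : ∀ n, T n → ℕ)
    (a b : Coeffs) : Series :=
  PowerSeries.mk fun n =>
    letI := Fintype.ofFinite (T n)
    ∑ x : T n, a ^ f n x * b ^ g n x

/-- The objects of positive size are pairs of smaller objects, as for binary trees, such that `f`
and `g` count the nodes on the leftmost and on the rightmost branch. -/
structure IsCatalanPair (T : ℕ → Type) (f g : ∀ n, T n → ℕ) : Prop where
  zero : ∃ x : T 0, (∀ y, y = x) ∧ f 0 x = 0 ∧ g 0 x = 0
  succ : ∀ n, ∃ Φ : (Σ p : Finset.HasAntidiagonal.antidiagonal n, T p.1.1 × T p.1.2) → T (n + 1),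
    Function.Bijective Φ ∧ ∀ q, f _ (Φ q) = f _ q.2.1 + 1 ∧ g _ (Φ q) = g _ q.2.2 + 1

/-- The left component alone carries the exponent of `a` and the right one that of `b`, so the other
weight is 1 in each factor. The two increments contribute `a * b`. -/
theorem IsCatalanPair.weightSeries_eq {T : ℕ → Type} [∀ n, Finite (T n)] {f g : ∀ n, T n → ℕ}
    (h : IsCatalanPair T f g) (a b : Coeffs) :
    weightSeries T f g a b = 1 + PowerSeries.X *
      (PowerSeries.C (a * b) * (weightSeries T f g a 1 * weightSeries T f g 1 b)) := by
  classical
  let _ : ∀ n, Fintype (T n) := fun n => Fintype.ofFinite (T n)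
  ext1 n
  cases n with
  | zero =>
    obtain ⟨x, hx, hf, hg⟩ := h.zero
    have hu : (Finset.univ : Finset (T 0)) = {x} := by
      ext y; simp [hx y]
    simp [weightSeries, hu, hf, hg]
  | succ n =>
    obtain ⟨Φ, hΦ, hs⟩ := h.succ n
    rw [map_add, PowerSeries.coeff_succ_X_mul, PowerSeries.coeff_C_mul, PowerSeries.coeff_mul]
    have h1 : (PowerSeries.coeff (n + 1)) (1 : Series) = 0 := by
      simp [PowerSeries.coeff_one]
    rw [h1, zero_add]
    simp only [weightSeries, PowerSeries.coeff_mk]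
    rw [← Function.Bijective.sum_comp hΦ, Fintype.sum_sigma, Finset.mul_sum,
      ← Finset.sum_coe_sort (Finset.HasAntidiagonal.antidiagonal n)]
    refine Finset.sum_congr rfl fun p _ => ?_
    rw [Fintype.sum_prod_type, Finset.sum_mul_sum, Finset.mul_sum]
    refine Finset.sum_congr rfl fun u _ => ?_
    rw [Finset.mul_sum]
    refine Finset.sum_congr rfl fun v _ => ?_
    obtain ⟨h1, h2⟩ := hs ⟨p, u, v⟩
    rw [h1, h2]
    ring

theorem catalanGF_eq : 1 + PowerSeries.X * catalanGF ^ 2 = catalanGF := by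
  have h := congrArg (PowerSeries.map (Nat.castRingHom Coeffs))
    PowerSeries.catalanSeries_sq_mul_X_add_one
  simp only [map_add, map_mul, map_pow, PowerSeries.map_X, map_one] at h
  rw [catalanGF]
  linear_combination h

/-- Subtracting the two quadratic equations leaves the factor `1 - X * (F + catalanGF)`, which has
constant coefficient 1. So the quadratic has a single power series root. -/
theorem eq_catalanGF {F : Series} (hF : 1 + PowerSeries.X * F ^ 2 = F) : F = catalanGF := by
  have hC := catalanGF_eq
  have h : (1 - PowerSeries.X * (F + catalanGF)) * (F - catalanGF) = 0 := by
    linear_combination hC - hF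
  rcases mul_eq_zero.1 h with h | h
  · have := congrArg PowerSeries.constantCoeff h
    simp at this
  · exact sub_eq_zero.1 h

theorem eq_ballotGF {x : Coeffs} {F : Series}
    (hF : F = 1 + PowerSeries.X * (PowerSeries.C x * (F * catalanGF))) : F = ballotGF x := by
  have h := ballotGF_spec x
  linear_combination (ballotGF x) * hF - F * h

/-- The generating function of a Catalan family. -/
theorem IsCatalanPair.genFun_eq {T : ℕ → Type} [∀ n, Finite (T n)] {f g : ∀ n, T n → ℕ}
    (h : IsCatalanPair T f g) :
    genFun T f g = 1 + serY * serZ * serT * ballotGF varY * ballotGF varZ := by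
  -- With both weights 1 the functional equation is the Catalan quadratic; with only one weight 1 it
  -- is linear, since one factor is then the known `catalanGF`.
  have h11 : weightSeries T f g 1 1 = catalanGF := by
    refine eq_catalanGF ?_
    conv_rhs => rw [h.weightSeries_eq]
    simp [sq]
  have h1 : ∀ a, weightSeries T f g a 1 = ballotGF a := fun a => by
    refine eq_ballotGF ?_
    conv_lhs => rw [h.weightSeries_eq, h11]
    simp
  have h2 : ∀ b, weightSeries T f g 1 b = ballotGF b := fun b => by
    refine eq_ballotGF ?_
    conv_lhs => rw [h.weightSeries_eq, h11]
    simp [mul_comm]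
  change weightSeries T f g varY varZ = _
  rw [h.weightSeries_eq, h1, h2, serY, serZ, serT, map_mul]
  ring

theorem genFun_congr {T S : ℕ → Type} [∀ n, Finite (T n)] [∀ n, Finite (S n)]
    {f g : ∀ n, T n → ℕ} {f' g' : ∀ n, S n → ℕ} (φ : ∀ n, T n → S n)
    (hφ : ∀ n, Function.Bijective (φ n)) (hf : ∀ n x, f' n (φ n x) = f n x)
    (hg : ∀ n x, g' n (φ n x) = g n x) : genFun T f g = genFun S f' g' := by
  ext1 n
  let _ := Fintype.ofFinite (T n)
  let _ := Fintype.ofFinite (S n)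
  simp only [genFun, PowerSeries.coeff_mk]
  rw [← Function.Bijective.sum_comp (hφ n)]
  exact Finset.sum_congr rfl fun x _ => by rw [hf, hg]

/-! ### The square root and the first closed form -/

theorem sqrtSeries_eq : sqrtSeries = 1 - 2 * (PowerSeries.X * catalanGF) := by
  -- Both sides have the same square; the sum of the two candidates has constant coefficient 2,
  -- which excludes the opposite sign.
  have h : (sqrtSeries - (1 - 2 * (PowerSeries.X * catalanGF))) *
      (sqrtSeries + (1 - 2 * (PowerSeries.X * catalanGF))) = 0 := by
    linear_combination sqrtSeries_sq - 4 * PowerSeries.X * catalanGF_eq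
  rcases mul_eq_zero.1 h with h | h
  · exact sub_eq_zero.1 h
  · have := congrArg PowerSeries.constantCoeff h
    have h0 : PowerSeries.constantCoeff sqrtSeries = 1 := by
      rw [sqrtSeries, ← PowerSeries.coeff_zero_eq_constantCoeff_apply, PowerSeries.coeff_rescale]
      simp [PowerSeries.binomialSeries_coeff]
    rw [map_add, h0] at this
    simp only [map_sub, map_one, map_mul, PowerSeries.constantCoeff_X, zero_mul, mul_zero,
      sub_zero, map_zero] at this
    norm_num at this

theorem one_sub_ne_zero (x : Coeffs) :
    (1 - PowerSeries.C x * PowerSeries.X * catalanGF : Series) ≠ 0 := fun h => by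
  have := congrArg PowerSeries.constantCoeff h
  simp at this

theorem toFrac_injective : Function.Injective toFrac :=
  IsFractionRing.injective Series SeriesFrac

/-- From 1 - s = 2tC, each factor 2t - xt(1 - s) of the denominator equals 2t(1 - xtC). The powers
of 2t cancel and leave the inverses of 1 - xtC. -/
theorem closedForm {F : Series}
    (hF : F = 1 + serY * serZ * serT * ballotGF varY * ballotGF varZ) :
    let y := toFrac serY
    let z := toFrac serZ
    let t := toFrac serT
    let s := toFrac sqrtSeries
    (2 * t - y * t * (1 - s)) * (2 * t - z * t * (1 - s)) ≠ 0 ∧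
      toFrac F = 1 + (4 * t ^ 2 * y * z * t) /
        ((2 * t - y * t * (1 - s)) * (2 * t - z * t * (1 - s))) := by
  intro y z t s
  have hX : (serT : Series) ≠ 0 := PowerSeries.X_ne_zero
  have key : ∀ x : Coeffs, 2 * t - toFrac (PowerSeries.C x) * t * (1 - s) =
      2 * t * toFrac (1 - PowerSeries.C x * PowerSeries.X * catalanGF) := fun x => by
    have : toFrac (2 * serT - PowerSeries.C x * serT * (1 - sqrtSeries)) =
        toFrac (2 * serT * (1 - PowerSeries.C x * PowerSeries.X * catalanGF)) := by
      congr 1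
      rw [sqrtSeries_eq, serT]
      ring
    have h2 : toFrac 2 = 2 := map_ofNat _ 2
    simpa [t, s, h2] using this
  have ne : ∀ x : Coeffs, 2 * t * toFrac (1 - PowerSeries.C x * PowerSeries.X * catalanGF) ≠ 0 :=
    fun x => by
      have h2 : (2 : SeriesFrac) ≠ 0 := by
        rw [← map_ofNat toFrac 2]
        refine (map_ne_zero_iff _ toFrac_injective).2 fun h => ?_
        have := congrArg PowerSeries.constantCoeff h
        rw [map_zero] at this
        exact two_ne_zero ((map_ofNat _ 2).symm.trans this)
      refine mul_ne_zero (mul_ne_zero h2 ?_) ?_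
      · exact (map_ne_zero_iff _ toFrac_injective).2 hX
      · exact (map_ne_zero_iff _ toFrac_injective).2 (one_sub_ne_zero x)
  have hb : ∀ x : Coeffs, toFrac (1 - PowerSeries.C x * PowerSeries.X * catalanGF) *
      toFrac (ballotGF x) = 1 := fun x => by
    rw [← map_mul, ballotGF_spec, map_one]
  have hy := key varY
  have hz := key varZ
  change 2 * t - y * t * (1 - s) = _ at hy
  change 2 * t - z * t * (1 - s) = _ at hz
  rw [hy, hz]
  have hne := mul_ne_zero (ne varY) (ne varZ)
  refine ⟨hne, ?_⟩
  rw [hF, map_add, map_one]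
  congr 1
  rw [eq_div_iff hne]
  simp only [map_mul]
  linear_combination (4 * t ^ 3 * y * z) *
    (toFrac (1 - PowerSeries.C varZ * PowerSeries.X * catalanGF) * toFrac (ballotGF varZ) *
      hb varY + hb varZ)

/-! ### Ballot numbers as coefficients -/

theorem ballotNumber_zero (n : ℕ) : ballotNumber n 0 = 1 := by
  have : (n : ℚ) + 1 ≠ 0 := by positivity
  simp [ballotNumber, this]

theorem ballotNumber_succ_right (n : ℕ) : ballotNumber n (n + 1) = 0 := by
  simp [ballotNumber]

theorem ballotNumber_succ_succ (n k : ℕ) :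
    ballotNumber (n + 1) (k + 1) = ballotNumber (n + 1) k + ballotNumber n (k + 1) := by
  have h1 : ((n + 1 + (k + 1)).choose (k + 1) : ℚ) =
      (n + k + 1).choose k + (n + k + 1).choose (k + 1) := by
    rw [show n + 1 + (k + 1) = (n + k + 1) + 1 by ring, Nat.choose_succ_succ]
    push_cast; ring
  have h2 : ((n + k + 1).choose (k + 1) : ℚ) * (k + 1) = (n + k + 1).choose k * (n + 1) := by
    have := Nat.choose_succ_right_eq (n + k + 1) k
    rw [show n + k + 1 - k = n + 1 by omega] at this
    exact_mod_cast this
  have hn : (n : ℚ) + 1 ≠ 0 := by positivity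
  have hn' : (n : ℚ) + 1 + 1 ≠ 0 := by positivity
  simp only [ballotNumber]
  rw [h1, show n + 1 + k = n + k + 1 by ring, show n + (k + 1) = n + k + 1 by ring]
  push_cast
  field_simp
  linear_combination h2

theorem ballotNumber_self (n : ℕ) : ballotNumber n n = catalan n := by
  have hn : (n : ℚ) + 1 ≠ 0 := by positivity
  have h := succ_mul_catalan_eq_centralBinom n
  have h' : ((n : ℚ) + 1) * catalan n = (n + n).choose n := by
    rw [← two_mul]
    exact_mod_cast h
  rw [ballotNumber, ← h']
  field_simp
  ring

/-- The ballot recurrence shows that the right-hand side times 1 - x + x²t is 1 - x + xtC. The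
Catalan equation factors 1 - x + x²t as (1 - xtC)(1 - x + xtC), so `ballotGF x` has the same
product. -/
theorem ballotGF_eq (x : Coeffs) :
    ballotGF x = 1 + serT * PowerSeries.mk fun n =>
      ∑ k ∈ Finset.range (n + 1), MvPolynomial.C (ballotNumber n k) * x ^ (n + 1 - k) := by
  set s : ℕ → Coeffs := fun n =>
    ∑ k ∈ Finset.range (n + 1), MvPolynomial.C (ballotNumber n k) * x ^ (n + 1 - k) with hs
  have hx : ∀ n, ∀ u : ℕ → Coeffs, (∑ k ∈ Finset.range (n + 1), u k * x ^ (n + 1 - k)) =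
      x * ∑ k ∈ Finset.range (n + 1), u k * x ^ (n - k) := fun n u => by
    rw [Finset.mul_sum]
    refine Finset.sum_congr rfl fun k hk => ?_
    rw [Nat.succ_sub (Nat.lt_succ_iff.1 (Finset.mem_range.1 hk)), pow_succ]
    ring
  have rec' : ∀ n, s (n + 1) * (1 - x) + x ^ 2 * s n = x * MvPolynomial.C (catalan (n + 1) : ℚ) := by
    intro n
    -- Here the top term, a Catalan number, is split off; `e2` splits off the bottom term instead
    -- and applies the recurrence to the others. Combining them eliminates the inner sum over row
    -- n+1.
    have e1 : s (n + 1) = x * (x * ∑ k ∈ Finset.range (n + 1),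
        MvPolynomial.C (ballotNumber (n + 1) k) * x ^ (n - k)) +
        x * MvPolynomial.C (catalan (n + 1) : ℚ) := by
      rw [← hx, hs]
      simp only
      rw [hx, Finset.sum_range_succ, ballotNumber_self]
      simp
      ring
    have e2 : s (n + 1) = x * x ^ (n + 1) + x * ∑ k ∈ Finset.range (n + 1),
        MvPolynomial.C (ballotNumber (n + 1) k) * x ^ (n - k) +
        x * ∑ k ∈ Finset.range (n + 1), MvPolynomial.C (ballotNumber n (k + 1)) * x ^ (n - k) := by
      rw [hs]
      simp only
      rw [hx, Finset.sum_range_succ', ballotNumber_zero]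
      simp only [ballotNumber_succ_succ, map_add, add_mul, Finset.sum_add_distrib,
        Nat.add_sub_add_right]
      simp
      ring
    -- The term k = n+1 may be added freely because the ballot number vanishes there.
    have e3 : s n = x ^ (n + 1) + ∑ k ∈ Finset.range (n + 1),
        MvPolynomial.C (ballotNumber n (k + 1)) * x ^ (n - k) := by
      have := Finset.sum_range_succ' (fun k => MvPolynomial.C (ballotNumber n k) * x ^ (n + 1 - k))
        (n + 1)
      rw [Finset.sum_range_succ, ballotNumber_succ_right, ballotNumber_zero] at this
      simp only [Nat.add_sub_add_right] at this
      simp only [map_zero, zero_mul, add_zero, map_one, one_mul, Nat.sub_zero] at this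
      rw [hs]
      simp only
      rw [this]
      ring
    linear_combination e1 - x * e2 + x ^ 2 * e3
  have hrec : (1 - PowerSeries.C x + PowerSeries.C x ^ 2 * PowerSeries.X) *
      (1 + PowerSeries.X * PowerSeries.mk s) =
      1 - PowerSeries.C x + PowerSeries.C x * (PowerSeries.X * catalanGF) := by
    have h1 : (1 - PowerSeries.C x) * PowerSeries.mk s +
        PowerSeries.C (x ^ 2) * (1 + PowerSeries.X * PowerSeries.mk s) =
        PowerSeries.C x * catalanGF := by
      rw [show (1 : Series) - PowerSeries.C x = PowerSeries.C (1 - x) by simp]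
      ext1 n
      rw [map_add, PowerSeries.coeff_C_mul, PowerSeries.coeff_C_mul, PowerSeries.coeff_C_mul,
        PowerSeries.coeff_mk]
      cases n with
      | zero =>
        simp [hs, catalanGF, ballotNumber_zero, PowerSeries.catalanSeries_coeff]
        ring
      | succ n =>
        rw [map_add, PowerSeries.coeff_succ_X_mul, PowerSeries.coeff_mk]
        have := rec' n
        simp only [map_natCast] at this
        simp [PowerSeries.coeff_one, catalanGF, PowerSeries.catalanSeries_coeff]
        linear_combination this
    rw [map_pow] at h1
    linear_combination PowerSeries.X * h1
  have hB := ballotGF_spec x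
  have hC := catalanGF_eq
  -- The coefficients of 1 and t are 1 - x and x², which cannot both be zero.
  have hne : (1 - PowerSeries.C x + PowerSeries.C x ^ 2 * PowerSeries.X : Series) ≠ 0 := by
    intro h0
    have h0' := congrArg (PowerSeries.coeff 0) h0
    have h1' := congrArg (PowerSeries.coeff 1) h0
    rw [← map_pow] at h1'
    rw [show (1 : Series) - PowerSeries.C x = PowerSeries.C (1 - x) by simp] at h1'
    simp [PowerSeries.coeff_succ_mul_X] at h0' h1'
    simp [h1'] at h0'
  refine mul_left_cancel₀ hne ?_
  rw [serT]
  change _ = _ * (1 + PowerSeries.X * PowerSeries.mk s)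
  rw [hrec]
  linear_combination (1 - PowerSeries.C x + PowerSeries.C x * (PowerSeries.X * catalanGF)) * hB +
    PowerSeries.C x ^ 2 * PowerSeries.X * ballotGF x * hC

/-- `swapYZ` preserves the Catalan equation and exchanges the equations that determine the two
ballot series, so uniqueness of the solutions suffices. -/
theorem swapYZ_closedForm :
    swapYZ (1 + serY * serZ * serT * ballotGF varY * ballotGF varZ) =
      1 + serY * serZ * serT * ballotGF varY * ballotGF varZ := by
  have hC : swapYZ catalanGF = catalanGF := by
    refine eq_catalanGF ?_
    conv_rhs => rw [← catalanGF_eq]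
    simp [swapYZ]
  have hb : ∀ x x' : Coeffs, swapYZ (PowerSeries.C x) = PowerSeries.C x' →
      swapYZ (ballotGF x) = ballotGF x' := fun x x' hx => by
    refine eq_ballotGF ?_
    have := congrArg swapYZ (ballotGF_spec x)
    simp only [map_mul, map_sub, map_one, hC, hx] at this
    have hX : swapYZ PowerSeries.X = PowerSeries.X := by simp [swapYZ]
    rw [hX] at this
    linear_combination this
  have hy : swapYZ serY = serZ := by
    simp [swapYZ, serY, serZ, varY, varZ]
  have hz : swapYZ serZ = serY := by
    simp [swapYZ, serY, serZ, varY, varZ]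
  have ht : swapYZ serT = serT := by simp [swapYZ, serT]
  simp only [map_add, map_mul, map_one, hy, hz, ht, hb varY varZ hy, hb varZ varY hz]
  ring

/-! ### Encodings by functions, and their decompositions -/

/-- A function on `{0, …, n - 1}`, extended by zero, with `x < e x ≤ n` for all `x < n`. -/
def Valid (n : ℕ) (e : ℕ → ℕ) : Prop :=
  (∀ x < n, x < e x ∧ e x ≤ n) ∧ ∀ x, n ≤ x → e x = 0

/-- The monotone valid functions, a form of the Dyck paths. -/
def IsMono (n : ℕ) (e : ℕ → ℕ) : Prop :=
  Valid n e ∧ ∀ x y, x < y → y < n → e x ≤ e y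

/-- The valid functions such that no two of the intervals `[x, e x)` cross: they encode the ordered
forests, where `e x` is the end of the subtree with root `x` in preorder. -/
def IsNoncrossing (n : ℕ) (e : ℕ → ℕ) : Prop :=
  Valid n e ∧ ∀ x y, x < y → y < e x → e y ≤ e x

/-- The restricted growth functions that avoid `101`. -/
def IsRGF (n : ℕ) (α : ℕ → ℕ) : Prop :=
  (∀ x < n, ∀ v < α x, ∃ y < x, α y = v) ∧
    (∀ x y z, x < y → y < z → z < n → α x = α z → α x ≤ α y) ∧ ∀ x, n ≤ x → α x = 0

/-- The number of points below all values of `e`. -/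
def minC (n : ℕ) (e : ℕ → ℕ) : ℕ := ((Finset.range n).filter fun y => ∀ x < n, y < e x).card

/-- The number of points that no interval `[y, e y)` with `y < i` contains. -/
def cutC (n : ℕ) (e : ℕ → ℕ) : ℕ := ((Finset.range n).filter fun i => ∀ y < i, e y ≤ i).card

def zeroC (n : ℕ) (α : ℕ → ℕ) : ℕ := ((Finset.range n).filter fun x => α x = 0).card

def rminC (n : ℕ) (α : ℕ → ℕ) : ℕ :=
  ((Finset.range n).filter fun x => ∀ y < n, x < y → α x < α y).card

/-! ### Recursive decompositions of the three Catalan models -/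

theorem isCatalanPair_of_glue {P : ℕ → (ℕ → ℕ) → Prop} {f g : ℕ → (ℕ → ℕ) → ℕ}
    (glue : ℕ → ℕ → (ℕ → ℕ) → (ℕ → ℕ) → ℕ → ℕ)
    (hzero : P 0 0 ∧ (∀ e, P 0 e → e = 0) ∧ f 0 0 = 0 ∧ g 0 0 = 0)
    (hglue : ∀ k m A B, P k A → P m B → P (k + m + 1) (glue k m A B) ∧
      f (k + m + 1) (glue k m A B) = f k A + 1 ∧ g (k + m + 1) (glue k m A B) = g m B + 1)
    (hinj : ∀ k m A B k' m' A' B', P k A → P m B → P k' A' → P m' B' → k + m = k' + m' →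
      glue k m A B = glue k' m' A' B' → k = k' ∧ A = A' ∧ B = B')
    (hsurj : ∀ n e, P (n + 1) e →
      ∃ k m A B, k + m = n ∧ P k A ∧ P m B ∧ e = glue k m A B) :
    IsCatalanPair (fun n => {e // P n e}) (fun n e => f n e.1) (fun n e => g n e.1) where
  zero := ⟨⟨0, hzero.1⟩, fun y => Subtype.ext (hzero.2.1 _ y.2), hzero.2.2⟩
  succ n := by
    have hn : ∀ p : Finset.HasAntidiagonal.antidiagonal n, p.1.1 + p.1.2 = n := fun p =>
      Finset.HasAntidiagonal.mem_antidiagonal.1 p.2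
    refine ⟨fun q => ⟨glue q.1.1.1 q.1.1.2 q.2.1.1 q.2.2.1, ?_⟩, ⟨?_, ?_⟩, ?_⟩
    · have := (hglue _ _ _ _ q.2.1.2 q.2.2.2).1
      rwa [hn] at this
    · rintro ⟨p, ⟨A, hA⟩, ⟨B, hB⟩⟩ ⟨p', ⟨A', hA'⟩, ⟨B', hB'⟩⟩ h
      obtain ⟨h1, rfl, rfl⟩ := hinj _ _ _ _ _ _ _ _ hA hB hA' hB'
        ((hn p).trans (hn p').symm) (congrArg Subtype.val h)
      have h2 : p = p' := by
        have e1 := hn p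
        have e2 := hn p'
        ext
        exact h1
      subst h2
      rfl
    · rintro ⟨e, he⟩
      obtain ⟨k, m, A, B, hkm, hA, hB, rfl⟩ := hsurj n e he
      exact ⟨⟨⟨(k, m), Finset.HasAntidiagonal.mem_antidiagonal.2 hkm⟩, ⟨A, hA⟩, ⟨B, hB⟩⟩, rfl⟩
    · intro q
      have := (hglue _ _ _ _ q.2.1.2 q.2.2.2).2
      rwa [hn] at this

theorem finite_subtype_of_bounded (n : ℕ) {P : (ℕ → ℕ) → Prop}
    (h : ∀ e, P e → (∀ x < n, e x ≤ n) ∧ ∀ x, n ≤ x → e x = 0) : Finite {e // P e} := by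
  refine Finite.of_injective
    (fun (e : {e // P e}) (x : Fin n) => (⟨e.1 x, Nat.lt_succ_of_le ((h _ e.2).1 x x.2)⟩ :
      Fin (n + 1))) ?_
  intro e e' he
  ext x
  by_cases hx : x < n
  · exact congrArg Fin.val (congrFun he ⟨x, hx⟩)
  · rw [(h _ e.2).2 x (not_lt.1 hx), (h _ e'.2).2 x (not_lt.1 hx)]

instance finite_isMono (n : ℕ) : Finite {e // IsMono n e} :=
  finite_subtype_of_bounded n fun _ h => ⟨fun x hx => (h.1.1 x hx).2, h.1.2⟩

instance (n : ℕ) : Finite {e // IsNoncrossing n e} :=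
  finite_subtype_of_bounded n fun _ h => ⟨fun x hx => (h.1.1 x hx).2, h.1.2⟩

theorem IsRGF.le {n : ℕ} {α : ℕ → ℕ} (h : IsRGF n α) : ∀ x < n, α x ≤ x := by
  intro x
  induction x using Nat.strong_induction_on with
  | _ x ih =>
    intro hx
    by_contra! hlt
    obtain ⟨y, hy, hxy⟩ := h.1 x hx x hlt
    have := ih y hy (hy.trans hx)
    omega

instance (n : ℕ) : Finite {e // IsRGF n e} :=
  finite_subtype_of_bounded n fun _ h => ⟨fun x hx => (h.le x hx).trans hx.le, h.2.2⟩

/-- Used to see a statistic grow by one: the counted points are those of a component, shifted by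
`b`, and one new point that lies before the shifted range. -/
theorem card_insert_image {s t : Finset ℕ} {a b : ℕ} (ha : a < b)
    (h : ∀ x, x ∈ s ↔ x = a ∨ ∃ y ∈ t, y + b = x) : s.card = t.card + 1 := by
  have : s = insert a (t.image (· + b)) := by
    ext x; simp [h]
  rw [this, Finset.card_insert_of_notMem, Finset.card_image_of_injective _ (add_left_injective b)]
  simp only [Finset.mem_image, not_exists, not_and]
  omega

/-- The first-return decomposition of Dyck paths: k is the least index with e k = k+1. Before k the
values of A are raised by one, which excludes earlier returns; after k comes a translate of B. By
monotonicity `minC` is just e 0, hence read off A, while the cuts other than 0 lie after k and come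
from B. -/
theorem isCatalanPair_isMono :
    IsCatalanPair (fun n => {e // IsMono n e}) (fun n e => minC n e.1) (fun n e => cutC n e.1) := by
  have hmin : ∀ n e, IsMono n e → minC n e = e 0 := by
    intro n e he
    rcases Nat.eq_zero_or_pos n with rfl | hn
    · simp [minC, he.1.2 0 le_rfl]
    · have : ((Finset.range n).filter fun y => ∀ x < n, y < e x) = Finset.range (e 0) := by
        ext y
        simp only [Finset.mem_filter, Finset.mem_range]
        constructor
        · exact fun h => h.2 0 hn
        · intro hy
          refine ⟨hy.trans_le (he.1.1 0 hn).2, fun x hx => ?_⟩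
          rcases Nat.eq_zero_or_pos x with rfl | hx'
          · exact hy
          · exact hy.trans_le (he.2 0 x hx' hx)
      rw [minC, this, Finset.card_range]
  have hP : ∀ k m A B, IsMono k A → IsMono m B → IsMono (k + m + 1) fun i =>
      if i < k then A i + 1 else if i = k then k + 1 else
        if i < k + m + 1 then B (i - (k + 1)) + (k + 1) else 0 := by
    intro k m A B hA hB
    refine ⟨⟨fun x hx => ?_, fun x hx => ?_⟩, fun x y hxy hy => ?_⟩ <;> beta_reduce
    · have h1 := hA.1.1 x
      have h2 := hB.1.1 (x - (k + 1))
      split_ifs <;> omega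
    · split_ifs <;> omega
    · have h1 := hA.1.1 x
      have h2 := hB.1.1 (x - (k + 1))
      have h1' := hA.1.1 y
      have h2' := hB.1.1 (y - (k + 1))
      have h3 := hA.2 x y hxy
      have h4 := hB.2 (x - (k + 1)) (y - (k + 1))
      split_ifs <;> omega
  refine isCatalanPair_of_glue (fun k m A B i => if i < k then A i + 1 else if i = k then k + 1 else
        if i < k + m + 1 then B (i - (k + 1)) + (k + 1) else 0) ?_ ?_ ?_ ?_
  · refine ⟨⟨⟨by simp, by simp⟩, by simp⟩, fun e he => ?_, by simp [minC], by simp [cutC]⟩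
    funext x
    exact he.1.2 x (Nat.zero_le _)
  · intro k m A B hA hB
    refine ⟨hP k m A B hA hB, ?_, ?_⟩
    · rw [hmin _ _ (hP k m A B hA hB), hmin _ _ hA]
      have := hA.1.2 0
      split_ifs <;> omega
    · refine card_insert_image (a := 0) (b := k + 1) (by omega) fun x => ?_
      simp only [Finset.mem_filter, Finset.mem_range]
      constructor
      · rintro ⟨hx, h⟩
        by_cases hx0 : x = 0
        · exact Or.inl hx0
        · have hk : k < x := by
            by_contra hk
            have h1 := h (x - 1) (by omega)
            have h2 := hA.1.1 (x - 1) (by omega)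
            rw [if_pos (by omega)] at h1
            omega
          refine Or.inr ⟨x - (k + 1), ⟨by omega, fun y hy => ?_⟩, by omega⟩
          have h1 := h (y + (k + 1)) (by omega)
          rw [if_neg (by omega), if_neg (by omega), if_pos (by omega), Nat.add_sub_cancel] at h1
          omega
      · rintro (rfl | ⟨z, ⟨hz, h⟩, rfl⟩)
        · exact ⟨by omega, by omega⟩
        · refine ⟨by omega, fun y hy => ?_⟩
          have h1 := hA.1.1 y
          have h2 := h (y - (k + 1))
          split_ifs <;> omega
  · intro k m A B k' m' A' B' hA hB hA' hB' hkm h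
    have hk : k = k' := by
      have h1 := congrFun h k
      have h2 := congrFun h k'
      have h3 := hA.1.1 k'
      have h4 := hA'.1.1 k
      beta_reduce at h1 h2
      split_ifs at h1 h2 <;> omega
    subst hk
    refine ⟨rfl, ?_, ?_⟩
    · funext x
      have h1 := congrFun h x
      have h2 := hA.1.2 x
      have h3 := hA'.1.2 x
      beta_reduce at h1
      split_ifs at h1 <;> omega
    · funext x
      have h1 := congrFun h (x + (k + 1))
      have h2 := hB.1.2 x
      have h3 := hB'.1.2 x
      beta_reduce at h1
      rw [Nat.add_sub_cancel] at h1
      split_ifs at h1 <;> omega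
  · intro n e he
    -- The last index always qualifies, as n < e n ≤ n + 1.
    have hex : ∃ k, k ≤ n ∧ e k = k + 1 := ⟨n, le_rfl, by have := he.1.1 n; omega⟩
    classical
    obtain ⟨hkn, hk⟩ := Nat.find_spec hex
    have hmin' := fun x => Nat.find_min (m := x) hex
    set k := Nat.find hex
    refine ⟨k, n - k, fun i => if i < k then e i - 1 else 0,
      fun i => if i < n - k then e (i + (k + 1)) - (k + 1) else 0, by omega,
      ⟨⟨fun x hx => ?_, fun x hx => ?_⟩, fun x y hxy hy => ?_⟩,
      ⟨⟨fun x hx => ?_, fun x hx => ?_⟩, fun x y hxy hy => ?_⟩, ?_⟩ <;> beta_reduce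
    · have h1 := he.1.1 x
      have h2 := hmin' x
      have h3 := he.2 x k
      rw [if_pos hx]
      omega
    · rw [if_neg (by omega)]
    · have := he.2 x y
      rw [if_pos hy, if_pos (by omega)]
      omega
    · have := he.1.1 (x + (k + 1))
      rw [if_pos hx]
      omega
    · rw [if_neg (by omega)]
    · have := he.2 (x + (k + 1)) (y + (k + 1))
      rw [if_pos hy, if_pos (by omega)]
      omega
    · funext x
      have h1 := he.1.1 x
      have h2 := he.1.2 x
      split_ifs with c1 c2 c3
      · omega
      · rw [c2, hk]
      · rw [Nat.sub_add_cancel (by omega : k + 1 ≤ x)]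
        omega
      · omega
      · omega

/-- The first tree of the forest has root 0 and occupies [0, k+1). A is the forest below that root
and B the forest of the remaining trees. A point below all values is smaller than e 0 = k+1, so it
is 0 or comes from A; a nonzero cut cannot lie inside the first tree, so it comes from B. -/
theorem isCatalanPair_isNoncrossing :
    IsCatalanPair (fun n => {e // IsNoncrossing n e}) (fun n e => minC n e.1)
      (fun n e => cutC n e.1) := by
  have hP : ∀ k m A B, IsNoncrossing k A → IsNoncrossing m B → IsNoncrossing (k + m + 1) fun i =>
      if i = 0 then k + 1 else if i < k + 1 then A (i - 1) + 1 else
        if i < k + m + 1 then B (i - (k + 1)) + (k + 1) else 0 := by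
    intro k m A B hA hB
    refine ⟨⟨fun x hx => ?_, fun x hx => ?_⟩, fun x y hxy hy => ?_⟩ <;> beta_reduce
    · have h1 := hA.1.1 (x - 1)
      have h2 := hB.1.1 (x - (k + 1))
      split_ifs <;> omega
    · split_ifs <;> omega
    · have h1 := hA.1.1 (x - 1)
      have h2 := hB.1.1 (x - (k + 1))
      have h1' := hA.1.1 (y - 1)
      have h2' := hB.1.1 (y - (k + 1))
      have h3 := hA.2 (x - 1) (y - 1)
      have h4 := hB.2 (x - (k + 1)) (y - (k + 1))
      beta_reduce at hy ⊢
      split_ifs at hy ⊢ <;> omega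
  refine isCatalanPair_of_glue (fun k m A B i => if i = 0 then k + 1 else
    if i < k + 1 then A (i - 1) + 1 else
        if i < k + m + 1 then B (i - (k + 1)) + (k + 1) else 0) ?_ ?_ ?_ ?_
  · refine ⟨⟨⟨by simp, by simp⟩, by simp⟩, fun e he => ?_, by simp [minC], by simp [cutC]⟩
    funext x
    exact he.1.2 x (Nat.zero_le _)
  · intro k m A B hA hB
    refine ⟨hP k m A B hA hB, ?_, ?_⟩
    · refine card_insert_image (a := 0) (b := 1) (by omega) fun x => ?_
      simp only [Finset.mem_filter, Finset.mem_range]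
      constructor
      · rintro ⟨hx, h⟩
        by_cases hx0 : x = 0
        · exact Or.inl hx0
        · have h0 := h 0 (by omega)
          rw [if_pos rfl] at h0
          refine Or.inr ⟨x - 1, ⟨by omega, fun y hy => ?_⟩, by omega⟩
          have h1 := h (y + 1) (by omega)
          rw [if_neg (by omega), if_pos (by omega), Nat.add_sub_cancel] at h1
          omega
      · rintro (rfl | ⟨z, ⟨hz, h⟩, rfl⟩)
        · refine ⟨by omega, fun y hy => ?_⟩
          split_ifs <;> omega
        · refine ⟨by omega, fun y hy => ?_⟩
          have h2 := h (y - 1)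
          split_ifs <;> omega
    · refine card_insert_image (a := 0) (b := k + 1) (by omega) fun x => ?_
      simp only [Finset.mem_filter, Finset.mem_range]
      constructor
      · rintro ⟨hx, h⟩
        by_cases hx0 : x = 0
        · exact Or.inl hx0
        · have h0 := h 0 (by omega)
          rw [if_pos rfl] at h0
          refine Or.inr ⟨x - (k + 1), ⟨by omega, fun y hy => ?_⟩, by omega⟩
          have h1 := h (y + (k + 1)) (by omega)
          rw [if_neg (by omega), if_neg (by omega), if_pos (by omega), Nat.add_sub_cancel] at h1
          omega
      · rintro (rfl | ⟨z, ⟨hz, h⟩, rfl⟩)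
        · exact ⟨by omega, by omega⟩
        · refine ⟨by omega, fun y hy => ?_⟩
          have h1 := hA.1.1 (y - 1)
          have h2 := h (y - (k + 1))
          split_ifs <;> omega
  · intro k m A B k' m' A' B' hA hB hA' hB' hkm h
    have hk : k = k' := by
      have h1 := congrFun h 0
      simpa using h1
    subst hk
    refine ⟨rfl, ?_, ?_⟩
    · funext x
      have h1 := congrFun h (x + 1)
      have h2 := hA.1.2 x
      have h3 := hA'.1.2 x
      beta_reduce at h1
      rw [Nat.add_sub_cancel, if_neg (Nat.succ_ne_zero x), if_neg (Nat.succ_ne_zero x)] at h1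
      split_ifs at h1 <;> omega
    · funext x
      have h1 := congrFun h (x + (k + 1))
      have h2 := hB.1.2 x
      have h3 := hB'.1.2 x
      beta_reduce at h1
      rw [Nat.add_sub_cancel, if_neg (by omega : ¬x + (k + 1) = 0),
        if_neg (by omega : ¬x + (k + 1) = 0)] at h1
      split_ifs at h1 <;> omega
  · intro n e he
    have h0 := he.1.1 0 (by omega)
    obtain ⟨k, hk⟩ : ∃ k, e 0 = k + 1 := ⟨e 0 - 1, by omega⟩
    refine ⟨k, n - k, fun i => if i < k then e (i + 1) - 1 else 0,
      fun i => if i < n - k then e (i + (k + 1)) - (k + 1) else 0, by omega,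
      ⟨⟨fun x hx => ?_, fun x hx => ?_⟩, fun x y hxy hy => ?_⟩,
      ⟨⟨fun x hx => ?_, fun x hx => ?_⟩, fun x y hxy hy => ?_⟩, ?_⟩ <;> beta_reduce
    · have h1 := he.1.1 (x + 1)
      have h3 := he.2 0 (x + 1)
      rw [if_pos hx]
      omega
    · rw [if_neg (by omega)]
    · have := he.2 (x + 1) (y + 1)
      beta_reduce at hy ⊢
      split_ifs at hy ⊢ <;> omega
    · have := he.1.1 (x + (k + 1))
      rw [if_pos hx]
      omega
    · rw [if_neg (by omega)]
    · have := he.2 (x + (k + 1)) (y + (k + 1))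
      beta_reduce at hy ⊢
      split_ifs at hy ⊢ <;> omega
    · funext x
      have h1 := he.1.1 x
      have h2 := he.1.2 x
      split_ifs with c1 c2 c3
      · rw [c1, hk]
      · rw [Nat.sub_add_cancel (by omega : 1 ≤ x)]
        omega
      · omega
      · rw [Nat.sub_add_cancel (by omega : k + 1 ≤ x)]
        omega
      · omega
      · omega

/-- The value 0 has to be excluded because the supremum of an empty word is also 0. -/
theorem IsRGF.lt_sup_iff {k : ℕ} {A : ℕ → ℕ} (h : IsRGF k A) (v : ℕ) (hv : v ≠ 0) :
    v < (Finset.range k).sup A + 1 ↔ ∃ x < k, A x = v := by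
  constructor
  · intro hlt
    have : 0 < k := by
      rcases Nat.eq_zero_or_pos k with rfl | hk
      · simp at hlt; omega
      · exact hk
    obtain ⟨x, hx, hs⟩ := Finset.exists_mem_eq_sup (Finset.range k) ⟨0, by simpa⟩ A
    rw [hs] at hlt
    rw [Finset.mem_range] at hx
    rcases (Nat.lt_succ_iff.1 hlt).lt_or_eq with hlt | rfl
    · obtain ⟨y, hy, hyv⟩ := h.1 x hx v hlt
      exact ⟨y, hy.trans hx, hyv⟩
    · exact ⟨x, hx, rfl⟩
  · rintro ⟨x, hx, rfl⟩
    exact Nat.lt_succ_of_le (Finset.le_sup (f := A) (Finset.mem_range.2 hx))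

/-- The word is split at its last zero, position k. Avoiding 101 forbids letters of A from
reappearing after it, so the rest is B raised above all letters of A and above 0. Zeros are those of
A and the one at k; right-to-left minima are k and those of B, since no position before k can be
strictly below the zero at k. -/
theorem isCatalanPair_isRGF :
    IsCatalanPair (fun n => {α // IsRGF n α}) (fun n α => zeroC n α.1)
      (fun n α => rminC n α.1) := by
  have hle : ∀ k (A : ℕ → ℕ) x, x < k → A x < (Finset.range k).sup A + 1 := fun k A x hx =>
    Nat.lt_succ_of_le (Finset.le_sup (f := A) (Finset.mem_range.2 hx))
  refine isCatalanPair_of_glue (fun k m A B i => if i < k then A i else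
    if i = k then 0 else
        if i < k + m + 1 then B (i - (k + 1)) + ((Finset.range k).sup A + 1) else 0) ?_ ?_ ?_ ?_
  · refine ⟨⟨by simp, by simp⟩, fun e he => ?_, by simp [zeroC], by simp [rminC]⟩
    funext x
    exact he.2.2 x (Nat.zero_le _)
  · intro k m A B hA hB
    refine ⟨⟨fun x hx v hv => ?_, fun x y z hxy hyz hz h => ?_, fun x hx => ?_⟩, ?_, ?_⟩ <;>
      beta_reduce
    · beta_reduce at hv
      split_ifs at hv with c1 c2
      · obtain ⟨y, hy, hyv⟩ := hA.1 x c1 v hv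
        exact ⟨y, hy, by rw [if_pos (by omega), hyv]⟩
      · omega
      · rcases lt_or_ge v ((Finset.range k).sup A + 1) with hv' | hv'
        · rcases Nat.eq_zero_or_pos v with rfl | hpos
          · exact ⟨k, by omega, by simp⟩
          · obtain ⟨y, hy, hyv⟩ := (hA.lt_sup_iff v (by omega)).1 hv'
            exact ⟨y, by omega, by rw [if_pos hy, hyv]⟩
        · obtain ⟨y, hy, hyv⟩ := hB.1 (x - (k + 1)) (by omega)
            (v - ((Finset.range k).sup A + 1)) (by omega)
          refine ⟨y + (k + 1), by omega, ?_⟩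
          rw [if_neg (by omega), if_neg (by omega), if_pos (by omega), Nat.add_sub_cancel, hyv]
          omega
    · have h1 := hle k A x
      have h2 := hA.2.1 x y z hxy hyz
      have h3 := hB.2.1 (x - (k + 1)) (y - (k + 1)) (z - (k + 1))
      beta_reduce at h ⊢
      split_ifs at h ⊢ <;> omega
    · split_ifs <;> omega
    · have : ((Finset.range (k + m + 1)).filter fun i => (if i < k then A i else
          if i = k then 0 else if i < k + m + 1 then
            B (i - (k + 1)) + ((Finset.range k).sup A + 1) else 0) = 0) =
          insert k ((Finset.range k).filter fun x => A x = 0) := by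
        ext x
        simp only [Finset.mem_filter, Finset.mem_range, Finset.mem_insert]
        split_ifs <;> grind
      rw [zeroC, this, Finset.card_insert_of_notMem (by simp)]
      rfl
    · refine card_insert_image (a := k) (b := k + 1) (by omega) fun x => ?_
      simp only [Finset.mem_filter, Finset.mem_range]
      constructor
      · rintro ⟨hx, h⟩
        by_cases hxk : x = k
        · exact Or.inl hxk
        · have hk : k < x := by
            by_contra hk
            have h1 := h k (by omega) (by omega)
            simp at h1
          refine Or.inr ⟨x - (k + 1), ⟨by omega, fun y hy hxy => ?_⟩, by omega⟩
          have h1 := h (y + (k + 1)) (by omega) (by omega)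
          rw [if_neg (by omega), if_neg (by omega), if_pos (by omega), if_neg (by omega),
            if_neg (by omega), if_pos (by omega), Nat.add_sub_cancel] at h1
          omega
      · rintro (rfl | ⟨z, ⟨hz, h⟩, rfl⟩)
        · refine ⟨by omega, fun y hy hxy => ?_⟩
          split_ifs <;> omega
        · refine ⟨by omega, fun y hy hxy => ?_⟩
          have h1 := h (y - (k + 1))
          rw [if_neg (by omega), if_neg (by omega), if_pos (by omega), if_neg (by omega),
            if_neg (by omega), if_pos (by omega), Nat.add_sub_cancel]
          omega
  · intro k m A B k' m' A' B' hA hB hA' hB' hkm h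
    have hk : k = k' := by
      have h1 := congrFun h k
      have h2 := congrFun h k'
      beta_reduce at h1 h2
      rw [if_neg (lt_irrefl k), if_pos rfl] at h1
      rw [if_neg (lt_irrefl k'), if_pos rfl] at h2
      split_ifs at h1 h2 <;> omega
    subst hk
    have hAA : A = A' := by
      funext x
      have h1 := congrFun h x
      have h2 := hA.2.2 x
      have h3 := hA'.2.2 x
      beta_reduce at h1
      by_cases hx : x < k
      · simpa [hx] using h1
      · rw [h2 (by omega), h3 (by omega)]
    subst hAA
    refine ⟨rfl, rfl, ?_⟩
    funext x
    have h1 := congrFun h (x + (k + 1))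
    have h2 := hB.2.2 x
    have h3 := hB'.2.2 x
    beta_reduce at h1
    rw [Nat.add_sub_cancel] at h1
    split_ifs at h1 <;> omega
  · intro n α hα
    have h00 : α 0 = 0 := by
      by_contra h
      obtain ⟨y, hy, -⟩ := hα.1 0 (by omega) 0 (by omega)
      omega
    obtain ⟨k, hkn, hk, hmax⟩ : ∃ k ≤ n, α k = 0 ∧ ∀ y ≤ n, k < y → α y ≠ 0 := by
      refine ⟨Nat.findGreatest (fun k => α k = 0) n, Nat.findGreatest_le n,
        Nat.findGreatest_spec (P := fun k => α k = 0) (Nat.zero_le n) h00, fun y hy hlt => ?_⟩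
      exact Nat.findGreatest_is_greatest (P := fun k => α k = 0) hlt hy
    set s := (Finset.range k).sup (fun i => if i < k then α i else 0) + 1 with hs
    have hA : IsRGF k fun i => if i < k then α i else 0 := by
      refine ⟨fun x hx v hv => ?_, fun x y z hxy hyz hz h => ?_, fun x hx => ?_⟩ <;> beta_reduce
      · beta_reduce at hv
        rw [if_pos hx] at hv
        obtain ⟨y, hy, h⟩ := hα.1 x (by omega) v hv
        exact ⟨y, hy, by rw [if_pos (by omega), h]⟩
      · have := hα.2.1 x y z hxy hyz (by omega)
        beta_reduce at h
        rw [if_pos (by omega), if_pos (by omega)] at h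
        rw [if_pos (by omega), if_pos (by omega)]
        exact this h
      · rw [if_neg (by omega)]
    -- A smaller nonzero letter would already occur before k, and with the zero at k it would form
    -- 101.
    have hbig : ∀ y ≤ n, k < y → s ≤ α y := by
      intro y hy hky
      by_contra! hlt
      obtain ⟨x, hx, hxy⟩ := (hA.lt_sup_iff (α y) (hmax y hy hky)).1 hlt
      rw [if_pos hx] at hxy
      have h1 := hα.2.1 x k y hx hky (by omega) hxy
      have h2 := hmax y hy hky
      omega
    refine ⟨k, n - k, fun i => if i < k then α i else 0,
      fun i => if i < n - k then α (i + (k + 1)) - s else 0, by omega, hA,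
      ⟨fun x hx v hv => ?_, fun x y z hxy hyz hz h => ?_, fun x hx => ?_⟩, ?_⟩ <;> beta_reduce
    · beta_reduce at hv
      rw [if_pos hx] at hv
      obtain ⟨y, hy, h⟩ := hα.1 (x + (k + 1)) (by omega) (v + s) (by omega)
      have hky : k < y := by
        rcases lt_trichotomy y k with hyk | rfl | hyk
        · have := hle k (fun i => if i < k then α i else 0) y hyk
          beta_reduce at this
          rw [if_pos hyk, ← hs] at this
          omega
        · omega
        · exact hyk
      refine ⟨y - (k + 1), by omega, ?_⟩
      rw [if_pos (by omega), Nat.sub_add_cancel (by omega), h]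
      omega
    · have h1 := hα.2.1 (x + (k + 1)) (y + (k + 1)) (z + (k + 1)) (by omega) (by omega) (by omega)
      have h2 := hbig (x + (k + 1)) (by omega) (by omega)
      have h3 := hbig (z + (k + 1)) (by omega) (by omega)
      beta_reduce at h
      rw [if_pos (by omega), if_pos (by omega)] at h
      rw [if_pos (by omega), if_pos (by omega)]
      omega
    · rw [if_neg (by omega)]
    · funext x
      have h2 := hα.2.2 x
      have h3 := hbig x
      rw [← hs]
      split_ifs with c1 c2 c3
      · rfl
      · rw [c2, hk]
      · rw [Nat.sub_add_cancel (by omega : k + 1 ≤ x)]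
        omega
      · omega
      · omega

/-! ### Posets encoded by functions -/

section Poset

variable {α β : Type} [PartialOrder α] [PartialOrder β] {n : ℕ}

/-- In the labelling `v` of its elements by `0, …, n - 1`, the elements above `x` are the last ones,
beginning with the label `e x`. -/
structure Codes (v : α ≃ Fin n) (e : ℕ → ℕ) : Prop where
  valid : Valid n e
  lt_iff : ∀ x y, x < y ↔ e (v x) ≤ v y

/-- `e` encodes a poset that contains **3+1**. -/
def HasThreePlusOne (n : ℕ) (e : ℕ → ℕ) : Prop :=
  ∃ a b c d, b < n ∧ c < n ∧ d < e a ∧ e a ≤ b ∧ e b ≤ c ∧ c < e d ∧ d < n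

/-- `e` encodes a poset that contains **N**. -/
def HasN (n : ℕ) (e : ℕ → ℕ) : Prop :=
  ∃ a b c d, d < n ∧ b < e a ∧ e a ≤ c ∧ c < e b ∧ e b ≤ d ∧ d < e c

theorem Valid.lt {e : ℕ → ℕ} (h : Valid n e) {x : ℕ} (hx : x < n) : x < e x := (h.1 x hx).1

theorem Valid.le {e : ℕ → ℕ} (h : Valid n e) (x : ℕ) : e x ≤ n := by
  by_cases hx : x < n
  · exact (h.1 x hx).2
  · simp [h.2 x (not_lt.1 hx)]

theorem Codes.le_iff {v : α ≃ Fin n} {e : ℕ → ℕ} (h : Codes v e) (x y : α) :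
    x ≤ y ↔ (v x : ℕ) = v y ∨ e (v x) ≤ v y := by
  rw [le_iff_eq_or_lt, h.lt_iff, ← Fin.ext_iff, v.injective.eq_iff]

theorem Codes.congr {v : α ≃ Fin n} {e : ℕ → ℕ} (h : Codes v e) (f : β ≃o α) :
    Codes (f.toEquiv.trans v) e where
  valid := h.valid
  lt_iff x y := by
    rw [← f.lt_iff_lt, h.lt_iff]
    rfl

theorem card_subtype_eq_card_filter {γ : Type} (v : γ ≃ Fin n) (p : ℕ → Prop) [DecidablePred p] :
    Nat.card {x : γ // p (v x)} = ((Finset.range n).filter p).card := by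
  rw [← Fintype.card_coe, ← Nat.card_eq_fintype_card]
  refine Nat.card_congr
    { toFun := fun x => ⟨v x.1, Finset.mem_filter.2 ⟨Finset.mem_range.2 (v x.1).2, x.2⟩⟩
      invFun := fun y => ⟨v.symm ⟨y.1, Finset.mem_range.1 (Finset.mem_filter.1 y.2).1⟩, ?_⟩
      left_inv := fun x => by simp
      right_inv := fun y => by simp }
  simpa using (Finset.mem_filter.1 y.2).2

theorem Codes.minCount_eq {v : α ≃ Fin n} {e : ℕ → ℕ} (h : Codes v e) :
    minCount α = minC n e := by
  rw [minC, ← card_subtype_eq_card_filter v]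
  refine Nat.card_congr (Equiv.subtypeEquivRight fun x => ?_)
  rw [isMin_iff_forall_not_lt]
  constructor
  · intro hx z hz
    have := hx (v.symm ⟨z, hz⟩)
    rw [h.lt_iff, Equiv.apply_symm_apply] at this
    exact not_le.1 this
  · intro hx z
    rw [h.lt_iff, not_le]
    exact hx _ (v z).2

/-- Two chains p < a and q < b without cross relations would give e p ≤ a < e q ≤ b < e p. -/
theorem Codes.isFreeOf_twoPlusTwo {v : α ≃ Fin n} {e : ℕ → ℕ} (h : Codes v e) :
    IsFreeOf α TwoPlusTwo := by
  refine ⟨fun f => ?_⟩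
  have h1 : f (Sum.inl 0) < f (Sum.inl 1) := by simp
  have h2 : f (Sum.inr 0) < f (Sum.inr 1) := by simp
  have h3 : ¬ f (Sum.inl 0) < f (Sum.inr 1) := by simp
  have h4 : ¬ f (Sum.inr 0) < f (Sum.inl 1) := by simp
  rw [h.lt_iff] at h1 h2 h3 h4
  omega

/-- Of the incomparabilities, only "d not above a" and "d not below c" need recording; the others
follow from the chain a < b < c. -/
theorem Codes.isFreeOf_threePlusOne_iff {v : α ≃ Fin n} {e : ℕ → ℕ} (h : Codes v e) :
    IsFreeOf α ThreePlusOne ↔ ¬ HasThreePlusOne n e := by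
  constructor
  · rintro ⟨hfree⟩ ⟨a, b, c, d, hb, hc, h1, h2, h3, h4, hd⟩
    have ha : a < n := by
      by_contra ha
      rw [h.valid.2 a (by omega)] at h1
      omega
    have ha' := h.valid.lt ha
    have hb' := h.valid.lt hb
    have hc' := h.valid.lt hc
    have hd' := h.valid.lt hd
    have hne : a ≠ d := by rintro rfl; omega
    refine hfree (OrderEmbedding.ofMapLEIff (fun q : ThreePlusOne =>
      v.symm (Sum.elim ![⟨a, ha⟩, ⟨b, hb⟩, ⟨c, hc⟩] ![⟨d, hd⟩] q)) ?_)
    intro p q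
    rw [h.le_iff, Equiv.apply_symm_apply, Equiv.apply_symm_apply]
    rcases p with p | p <;> rcases q with q | q <;> fin_cases p <;> fin_cases q <;> simp <;> omega
  · refine fun hno => ⟨fun f => hno ?_⟩
    have h1 : f (Sum.inl 0) < f (Sum.inl 1) := by simp
    have h2 : f (Sum.inl 1) < f (Sum.inl 2) := by simp
    have h3 : ¬ f (Sum.inl 0) < f (Sum.inr 0) := by simp
    have h4 : ¬ f (Sum.inr 0) < f (Sum.inl 2) := by simp
    rw [h.lt_iff] at h1 h2 h3 h4
    exact ⟨_, _, _, _, (v (f (Sum.inl 1))).2, (v (f (Sum.inl 2))).2, not_le.1 h3, h1, h2, not_le.1 h4,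
      (v (f (Sum.inr 0))).2⟩

theorem PosetN.le_iff (p q : PosetN) :
    p ≤ q ↔ p = q ∨ (p = .a ∧ q = .c) ∨ (p = .a ∧ q = .d) ∨ (p = .b ∧ q = .d) := by
  constructor
  · intro h
    cases (h : PosetN.Rel p q) <;> simp
  · rintro (rfl | ⟨rfl, rfl⟩ | ⟨rfl, rfl⟩ | ⟨rfl, rfl⟩)
    exacts [le_rfl, PosetN.Rel.ac, PosetN.Rel.ad, PosetN.Rel.bd]

theorem Codes.isFreeOf_posetN_iff {v : α ≃ Fin n} {e : ℕ → ℕ} (h : Codes v e) :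
    IsFreeOf α PosetN ↔ ¬ HasN n e := by
  constructor
  · rintro ⟨hfree⟩ ⟨a, b, c, d, hd, h1, h2, h3, h4, h5⟩
    have hc : c < n := by
      by_contra hc
      rw [h.valid.2 c (by omega)] at h5
      omega
    have hb : b < n := by
      by_contra hb
      rw [h.valid.2 b (by omega)] at h3
      omega
    have ha : a < n := by
      by_contra ha
      rw [h.valid.2 a (by omega)] at h1
      omega
    have ha' := h.valid.lt ha
    have hb' := h.valid.lt hb
    have hc' := h.valid.lt hc
    have hd' := h.valid.lt hd
    have hne : a ≠ b := by rintro rfl; omega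
    refine hfree (OrderEmbedding.ofMapLEIff (fun q : PosetN =>
      v.symm (PosetN.rec ⟨a, ha⟩ ⟨b, hb⟩ ⟨c, hc⟩ ⟨d, hd⟩ q)) ?_)
    intro p q
    rw [h.le_iff, Equiv.apply_symm_apply, Equiv.apply_symm_apply, PosetN.le_iff]
    cases p <;> cases q <;> simp <;> omega
  · refine fun hno => ⟨fun f => hno ?_⟩
    have key : ∀ p q : PosetN, p ≠ q → (f p < f q ↔ p ≤ q) := fun p q hpq => by
      rw [f.lt_iff_lt, lt_iff_le_and_ne, and_iff_left hpq]
    have h1 : f .a < f .c := by rw [key _ _ (by simp), PosetN.le_iff]; simp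
    have h2 : f .b < f .d := by rw [key _ _ (by simp), PosetN.le_iff]; simp
    have h3 : ¬ f .a < f .b := by rw [key _ _ (by simp), PosetN.le_iff]; simp
    have h4 : ¬ f .b < f .c := by rw [key _ _ (by simp), PosetN.le_iff]; simp
    have h5 : ¬ f .c < f .d := by rw [key _ _ (by simp), PosetN.le_iff]; simp
    rw [h.lt_iff] at h1 h2 h3 h4 h5
    exact ⟨_, _, _, _, (v (f .d)).2, not_le.1 h3, h1, not_le.1 h4, h2, not_le.1 h5⟩

/-! #### Labellings -/

/-- The sizes of the down-set and of the up-set of an element, the latter transformed by `g`. -/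
noncomputable def levelKey (g : ℕ → ℤ) (x : α) : ℕ ×ₗ ℤ :=
  toLex ((Set.Iio x).ncard, g (Set.Ioi x).ncard)

/-- Elements of `{0, …, n - 1}` with the same down-set are sorted according to `g` and to the size
of the up-set. -/
def TieSorted (g : ℕ → ℤ) (n : ℕ) (e : ℕ → ℕ) : Prop :=
  ∀ x y, x < y → y < n → (∀ z < n, x < e z → y < e z) → g (n - e x) ≤ g (n - e y)

theorem Codes.ncard_Ioi {v : α ≃ Fin n} {e : ℕ → ℕ} (h : Codes v e) (x : α) :
    (Set.Ioi x).ncard = n - e (v x) := by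
  have : v '' Set.Ioi x = ((Finset.univ.filter fun y : Fin n => e (v x) ≤ y : Finset (Fin n)) :
      Set (Fin n)) := by
    ext y
    simp [h.lt_iff]
  rw [← Set.ncard_image_of_injective _ v.injective, this, Set.ncard_coe_finset]
  have h2 : (Finset.univ.filter fun y : Fin n => e (v x) ≤ y).map Fin.valEmbedding =
      Finset.Ico (e (v x)) n := by
    ext y
    simp only [Finset.mem_map, Finset.mem_filter, Finset.mem_univ, true_and, Fin.valEmbedding_apply,
      Finset.mem_Ico]
    exact ⟨by rintro ⟨z, hz, rfl⟩; exact ⟨hz, z.2⟩, fun hy => ⟨⟨y, hy.2⟩, hy.1, rfl⟩⟩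
  rw [← Finset.card_map, h2, Nat.card_Ico]

/-- Down-sets grow along the labels of a code, so the first component of the key is automatically
sorted. Equal sizes then mean equal down-sets, which is where `TieSorted` governs the second
component. -/
theorem Codes.monotone_levelKey_iff {v : α ≃ Fin n} {e : ℕ → ℕ} (h : Codes v e) (g : ℕ → ℤ) :
    Monotone (levelKey g ∘ v.symm) ↔ TieSorted g n e := by
  have : Finite α := Finite.of_equiv _ v.symm
  have hup : ∀ x : Fin n, (Set.Ioi (v.symm x)).ncard = n - e x := fun x => by
    rw [h.ncard_Ioi, Equiv.apply_symm_apply]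
  constructor
  · intro hm x y hxy hy hz
    have hxn := hxy.trans hy
    have := hm (show (⟨x, hxn⟩ : Fin n) ≤ ⟨y, hy⟩ from hxy.le)
    have hI : Set.Iio (v.symm ⟨x, hxn⟩) = Set.Iio (v.symm ⟨y, hy⟩) := by
      ext z
      simp only [Set.mem_Iio, h.lt_iff, Equiv.apply_symm_apply]
      have := hz (v z) (v z).2
      omega
    simp only [Function.comp_apply, levelKey, hI, hup, Prod.Lex.toLex_le_toLex, lt_irrefl,
      false_or, true_and] at this
    exact this
  · intro ht x y hxy
    rcases hxy.eq_or_lt with rfl | hlt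
    · exact le_rfl
    have hsub : Set.Iio (v.symm x) ⊆ Set.Iio (v.symm y) := fun z hz => by
      simp only [Set.mem_Iio, h.lt_iff, Equiv.apply_symm_apply] at hz ⊢
      exact hz.trans hxy
    simp only [Function.comp_apply, levelKey, hup, Prod.Lex.toLex_le_toLex]
    rcases (Set.ncard_le_ncard hsub).lt_or_eq with hc | hc
    · exact Or.inl hc
    · refine Or.inr ⟨hc, ht x y hlt y.2 fun z hz hxz => ?_⟩
      by_contra! hzy
      have heq := Set.eq_of_subset_of_ncard_le hsub hc.ge
      have hmem : v.symm ⟨z, hz⟩ ∈ Set.Iio (v.symm y) := by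
        simpa [h.lt_iff] using hzy
      rw [← heq] at hmem
      simp only [Set.mem_Iio, h.lt_iff, Equiv.apply_symm_apply] at hmem
      omega

/-- Both labellings sort the same multiset of keys, so the sorted lists of keys agree even if the
labellings differ. By injectivity of `g` the key at position x determines n - e x. -/
theorem Codes.eq_of_tieSorted {g : ℕ → ℤ} (hg : Function.Injective g) {v v' : α ≃ Fin n}
    {e e' : ℕ → ℕ} (h : Codes v e) (h' : Codes v' e') (ht : TieSorted g n e)
    (ht' : TieSorted g n e') : e = e' := by
  have hm := (h.monotone_levelKey_iff g).2 ht
  have hm' := (h'.monotone_levelKey_iff g).2 ht'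
  have hcomp : (levelKey g ∘ v.symm) ∘ (v'.symm.trans v : Equiv.Perm (Fin n)) =
      levelKey g ∘ v'.symm := by
    funext x
    simp
  have := Tuple.unique_monotone (f := levelKey g ∘ v.symm) (σ := 1) (τ := v'.symm.trans v)
    hm (by rw [hcomp]; exact hm')
  rw [hcomp] at this
  funext x
  by_cases hx : x < n
  · have hk := congrArg (fun p => (ofLex p).2) (congrFun this ⟨x, hx⟩)
    have e1 := h.ncard_Ioi (v.symm ⟨x, hx⟩)
    have e2 := h'.ncard_Ioi (v'.symm ⟨x, hx⟩)
    rw [Equiv.apply_symm_apply] at e1 e2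
    simp only [Function.comp_apply, levelKey, ofLex_toLex, Equiv.Perm.coe_one, id_eq, e1, e2] at hk
    have h1 := hg hk
    have h2 := h.valid.le x
    have h3 := h'.valid.le x
    omega
  · rw [h.valid.2 x (not_lt.1 hx), h'.valid.2 x (not_lt.1 hx)]

theorem mem_iff_of_isUpperSet {S : Finset (Fin n)} (hS : IsUpperSet (S : Set (Fin n)))
    (y : Fin n) : y ∈ S ↔ n - S.card ≤ y := by
  constructor
  · intro hy
    have h1 : Finset.Ici y ⊆ S := fun z hz => hS (Finset.mem_Ici.1 hz) hy
    have h2 := Finset.card_le_card h1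
    rw [Fin.card_Ici] at h2
    omega
  · intro hy
    by_contra hmem
    have h1 : S ⊆ Finset.Ioi y := fun z hz => by
      rw [Finset.mem_Ioi]
      by_contra! hzy
      exact hmem (hS hzy hz)
    have h2 := Finset.card_le_card h1
    rw [Fin.card_Ioi] at h2
    have := y.2
    omega

/-- If p lies only below a and q only below b, then p < a and q < b are two chains with no relation
between them. -/
theorem IsFreeOf.Iio_total (h : IsFreeOf α TwoPlusTwo) (a b : α) :
    Set.Iio a ⊆ Set.Iio b ∨ Set.Iio b ⊆ Set.Iio a := by
  by_contra! hcon
  obtain ⟨p, hpa, hpb⟩ := Set.not_subset.1 hcon.1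
  obtain ⟨q, hqb, hqa⟩ := Set.not_subset.1 hcon.2
  simp only [Set.mem_Iio] at hpa hpb hqb hqa
  have h1 : ¬ p ≤ q := fun h => hpb (h.trans_lt hqb)
  have h2 : ¬ q ≤ p := fun h => hqa (h.trans_lt hpa)
  have h3 : ¬ p ≤ b := fun h => h.lt_or_eq.elim hpb fun h =>
    hqa (by rw [← h] at hqb; exact hqb.trans hpa)
  have h4 : ¬ q ≤ a := fun h => h.lt_or_eq.elim hqa fun h =>
    hpb (by rw [← h] at hpa; exact hpa.trans hqb)
  have h5 : ¬ a ≤ q := fun h => h1 (hpa.le.trans h)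
  have h6 : ¬ b ≤ p := fun h => h2 (hqb.le.trans h)
  have h7 : ¬ a ≤ b := fun h => hpb (hpa.trans_le h)
  have h8 : ¬ b ≤ a := fun h => hqa (hqb.trans_le h)
  have h9 := hpa.le
  have h10 := hqb.le
  have h11 := hpa.not_ge
  have h12 := hqb.not_ge
  refine h.false (OrderEmbedding.ofMapLEIff (Sum.elim ![p, a] ![q, b]) ?_)
  intro x y
  rcases x with x | x <;> rcases y with y | y <;> fin_cases x <;> fin_cases y <;> simp [*]

/-- Label by sorted keys. Since down-sets form a chain, their sizes decide inclusion; hence every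
up-set is a final segment of the labels, and its size gives its starting label. -/
theorem exists_codes (g : ℕ → ℤ) (w : α ≃ Fin n) (h : IsFreeOf α TwoPlusTwo) :
    ∃ (v : α ≃ Fin n) (e : ℕ → ℕ), Codes v e ∧ TieSorted g n e := by
  classical
  have : Finite α := Finite.of_equiv _ w.symm
  let v : α ≃ Fin n := w.trans (Tuple.sort (levelKey g ∘ w.symm)).symm
  have hm : Monotone (levelKey g ∘ v.symm) := Tuple.monotone_sort (levelKey g ∘ w.symm)
  have hup : ∀ z a b : α, z < a → v a ≤ v b → z < b := by
    intro z a b hza hab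
    have h1 := hm hab
    simp only [Function.comp_apply, Equiv.symm_apply_apply, levelKey,
      Prod.Lex.toLex_le_toLex] at h1
    have h2 : (Set.Iio a).ncard ≤ (Set.Iio b).ncard := by
      rcases h1 with h1 | h1
      · exact h1.le
      · exact h1.1.le
    have h3 : Set.Iio a ⊆ Set.Iio b := by
      rcases h.Iio_total a b with h3 | h3
      · exact h3
      · exact (Set.eq_of_subset_of_ncard_le h3 h2).ge
    exact h3 hza
  let e : ℕ → ℕ := fun x => if hx : x < n then n - (Set.Ioi (v.symm ⟨x, hx⟩)).ncard else 0
  have he : ∀ z : α, e (v z) = n - (Set.Ioi z).ncard := fun z => by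
    simp [e]
  have hlt : ∀ z y : α, z < y ↔ e (v z) ≤ v y := by
    intro z y
    have hfin : (v '' Set.Ioi z).Finite := Set.toFinite _
    have h1 := mem_iff_of_isUpperSet (S := hfin.toFinset) (by
      rw [Set.Finite.coe_toFinset]
      rintro a b hab ⟨c, hc, rfl⟩
      exact ⟨v.symm b, hup z c _ hc (by simpa using hab), by simp⟩) (v y)
    rw [← Set.ncard_eq_toFinset_card _ hfin, Set.ncard_image_of_injective _ v.injective, ← he] at h1
    rw [← h1]
    simp
  have hc : Codes v e := by
    refine ⟨⟨fun x hx => ⟨?_, ?_⟩, fun x hx => ?_⟩, hlt⟩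
    · have := hlt (v.symm ⟨x, hx⟩) (v.symm ⟨x, hx⟩)
      simp only [lt_irrefl, Equiv.apply_symm_apply, false_iff, not_le] at this
      exact this
    · simp [e, hx]
    · simp [e, not_lt.2 hx]
  exact ⟨v, e, hc, (hc.monotone_levelKey_iff g).1 hm⟩

end Poset

/-! ### Ordinal sums -/

section Poset

variable {α β : Type} [PartialOrder α] [PartialOrder β] {n : ℕ}

variable (α) in
/-- The nonempty lower parts of decompositions of a poset as an ordinal sum. -/
def ordinalCuts : Set (Set α) := {D | D.Nonempty ∧ ∀ x ∈ D, ∀ y ∉ D, x < y}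

theorem card_filter_Icc_one {n : ℕ} (p : ℕ → Prop) [DecidablePred p] (h0 : p 0) (hn : p n) :
    ((Finset.Icc 1 n).filter p).card = ((Finset.range n).filter p).card := by
  have h1 : (Finset.range (n + 1)).filter p = insert 0 ((Finset.Icc 1 n).filter p) := by
    ext x
    simp only [Finset.mem_filter, Finset.mem_range, Finset.mem_insert, Finset.mem_Icc]
    constructor
    · rintro ⟨hx, hp⟩
      rcases Nat.eq_zero_or_pos x with rfl | hx0
      · exact Or.inl rfl
      · exact Or.inr ⟨⟨hx0, by omega⟩, hp⟩
    · rintro (rfl | ⟨hx, hp⟩)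
      · exact ⟨by omega, h0⟩
      · exact ⟨by omega, hp⟩
  have h2 : (Finset.range (n + 1)).filter p = insert n ((Finset.range n).filter p) := by
    rw [Finset.range_add_one, Finset.filter_insert, if_pos hn]
  have h3 := congrArg Finset.card (h1.symm.trans h2)
  rw [Finset.card_insert_of_notMem (by simp), Finset.card_insert_of_notMem (by simp)] at h3
  omega

/-- Both 0 and n satisfy the condition, so block starts in [0, n) may be traded for block ends in
[1, n]. -/
theorem cutC_eq_Icc {e : ℕ → ℕ} (h : Valid n e) :
    cutC n e = ((Finset.Icc 1 n).filter fun i => ∀ y < i, e y ≤ i).card :=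
  (card_filter_Icc_one _ (by simp) fun y _ => h.le y).symm

/-- A cut must be an initial segment of the labels: an element outside it lies above its element of
largest label, hence has a larger label. -/
theorem Codes.ncard_ordinalCuts {v : α ≃ Fin n} {e : ℕ → ℕ} (h : Codes v e) :
    (ordinalCuts α).ncard = cutC n e := by
  have hfin : Finite α := Finite.of_equiv _ v.symm
  have : ordinalCuts α = (fun i : ℕ => {x : α | (v x : ℕ) < i}) ''
      ((Finset.Icc 1 n).filter fun i => ∀ y < i, e y ≤ i : Finset ℕ) := by
    ext D
    simp only [Finset.coe_filter, Finset.mem_Icc, Set.mem_image, Set.mem_ofPred_eq]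
    constructor
    · rintro ⟨hne, hD⟩
      obtain ⟨x, hx, hmax⟩ := Set.exists_max_image D v (Set.toFinite D) hne
      have hDeq : {y : α | (v y : ℕ) < v x + 1} = D := by
        ext y
        simp only [Set.mem_ofPred_eq]
        constructor
        · intro hy
          by_contra hyD
          have h1 := (h.lt_iff _ _).1 (hD x hx y hyD)
          have h2 := h.valid.lt (v x).2
          omega
        · exact fun hy => Nat.lt_succ_of_le (hmax y hy)
      refine ⟨v x + 1, ⟨⟨by omega, (v x).2⟩, fun y hy => ?_⟩, hDeq⟩
      rcases (Nat.succ_le_of_lt (v x).2).lt_or_eq with hlt | heq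
      · have hyn : y < n := by omega
        have h1 : v.symm ⟨y, hyn⟩ ∈ D := by
          rw [← hDeq, Set.mem_ofPred_eq, Equiv.apply_symm_apply]
          exact hy
        have h2 : v.symm ⟨v x + 1, hlt⟩ ∉ D := by
          rw [← hDeq, Set.mem_ofPred_eq, Equiv.apply_symm_apply]
          exact lt_irrefl _
        simpa [h.lt_iff] using hD _ h1 _ h2
      · have := h.valid.le y
        omega
    · rintro ⟨i, ⟨⟨h1, hn⟩, hi⟩, rfl⟩
      refine ⟨⟨v.symm ⟨0, by omega⟩, by simpa⟩, fun x hx y hy => ?_⟩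
      simp only [Set.mem_ofPred_eq, not_lt] at hx hy
      exact (h.lt_iff _ _).2 ((hi _ hx).trans hy)
  rw [this, Set.InjOn.ncard_image, Set.ncard_coe_finset, cutC_eq_Icc h.valid]
  intro i hi j hj hij
  simp only [Finset.coe_filter, Finset.mem_Icc, Set.mem_ofPred_eq] at hi hj
  have key : ∀ i j, 1 ≤ i → i ≤ n → {x : α | (v x : ℕ) < i} = {x | (v x : ℕ) < j} → i ≤ j := by
    intro i j h1 hn hij
    have : v.symm ⟨i - 1, by omega⟩ ∈ {x : α | (v x : ℕ) < i} := by simp; omega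
    rw [hij] at this
    simp at this
    omega
  exact le_antisymm (key i j hi.1.1 hi.1.2 hij) (key j i hj.1.1 hj.1.2 hij.symm)

/-- The cuts are exactly the unions of initial fibres, because a cut through the interior of a fibre
would make that fibre reducible. In particular all decompositions have the same number of summands.
-/
theorem IsOrdinalSumDecomposition.eq_ncard_ordinalCuts {k : ℕ} {f : α → Fin k}
    (hf : IsOrdinalSumDecomposition f) : k = (ordinalCuts α).ncard := by
  have hne : ∀ i, ∃ x, f x = i := fun i => by
    obtain ⟨x⟩ := (hf.2 i).1
    exact ⟨x.1, x.2⟩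
  have hcuts : ordinalCuts α = Set.range fun i : Fin k => {x | f x ≤ i} := by
    ext D
    constructor
    · rintro ⟨hD0, hD⟩
      have hfin : (f '' D).Finite := Set.toFinite _
      obtain ⟨i, ⟨⟨x, hxD, rfl⟩, hmax⟩⟩ := hfin.exists_maximal (hD0.image f)
      have hle : ∀ y ∈ D, f y ≤ f x := fun y hy => by
        by_contra! hlt
        exact hlt.not_ge (hmax ⟨y, hy, rfl⟩ hlt.le)
      refine ⟨f x, Set.ext fun y => ⟨fun hy => ?_, fun hy => hle y hy⟩⟩
      by_contra hyD
      rcases (show f y ≤ f x from hy).lt_or_eq with hlt | heq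
      · exact lt_asymm (hf.1 _ _ hlt) (hD x hxD y hyD)
      · refine (hf.2 (f x)).2 ⟨{z | z.1 ∈ D}, ⟨⟨x, rfl⟩, hxD⟩, ⟨⟨y, heq⟩, hyD⟩, ?_⟩
        exact fun u hu w hw => hD u.1 hu w.1 hw
    · rintro ⟨i, rfl⟩
      obtain ⟨x, hx⟩ := hne i
      refine ⟨⟨x, hx.le⟩, fun u hu w hw => hf.1 _ _ ?_⟩
      exact lt_of_le_of_lt hu (not_le.1 hw)
  have hinj : Function.Injective fun i : Fin k => {x | f x ≤ i} := by
    have key : ∀ i j, {x | f x ≤ i} = {x | f x ≤ j} → i ≤ j := fun i j hij => by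
      obtain ⟨x, hx⟩ := hne i
      have : x ∈ {x | f x ≤ i} := hx.le
      rw [hij] at this
      exact hx ▸ this
    exact fun i j hij => le_antisymm (key i j hij) (key j i hij.symm)
  rw [hcuts, ← Set.image_univ, Set.ncard_image_of_injective _ hinj, Set.ncard_univ, Nat.card_fin]

-- A decomposition into nonempty summands with as many summands as possible has irreducible
-- summands, since a reducible one could be split further.
variable (α) in
theorem exists_isOrdinalSumDecomposition [Finite α] :
    ∃ (k : ℕ) (f : α → Fin k), IsOrdinalSumDecomposition f := by
  classical
  let Q : ℕ → Prop := fun k => ∃ f : α → ℕ, (∀ x y, f x < f y → x < y) ∧ (∀ x, f x < k) ∧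
    ∀ i < k, ∃ x, f x = i
  have hbound : ∀ k, Q k → k ≤ Nat.card α := by
    rintro k ⟨f, -, hk, hsurj⟩
    have := Nat.card_le_card_of_surjective (fun x => (⟨f x, hk x⟩ : Fin k)) fun i => by
      obtain ⟨x, hx⟩ := hsurj i i.2
      exact ⟨x, Fin.ext hx⟩
    simpa using this
  have hex : ∃ k, Q k := by
    rcases isEmpty_or_nonempty α with hα | ⟨⟨a⟩⟩
    · exact ⟨0, fun _ => 0, fun x => hα.elim x, fun x => hα.elim x, by simp⟩
    · exact ⟨1, fun _ => 0, by simp, by simp, fun i hi => ⟨a, (Nat.lt_one_iff.1 hi).symm⟩⟩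
  obtain ⟨k, hk, hmax⟩ : ∃ k, Q k ∧ ∀ j, Q j → j ≤ k := by
    obtain ⟨k, hk⟩ := hex
    exact ⟨Nat.findGreatest Q (Nat.card α), Nat.findGreatest_spec (hbound k hk) hk,
      fun j hj => Nat.le_findGreatest (hbound j hj) hj⟩
  obtain ⟨f, hf, hlt, hsurj⟩ := hk
  refine ⟨k, fun x => ⟨f x, hlt x⟩, fun x y h => hf x y h, fun i => ⟨?_, ?_⟩⟩
  · obtain ⟨x, hx⟩ := hsurj i i.2
    exact ⟨⟨x, Fin.ext hx⟩⟩
  · rintro ⟨D, ⟨u, hu⟩, ⟨w, hw⟩, hD⟩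
    have hD' : ∀ x y : α, f x = i → f y = i → x ∈ Subtype.val '' D → y ∉ Subtype.val '' D →
        x < y := by
      rintro x y hx hy ⟨x', hx', rfl⟩ hyD
      exact hD x' hx' ⟨y, Fin.ext hy⟩ fun h => hyD ⟨_, h, rfl⟩
    have huD : u.1 ∈ Subtype.val '' D := ⟨u, hu, rfl⟩
    have hwD : w.1 ∉ Subtype.val '' D := by
      rintro ⟨w', hw', h⟩
      exact hw (Subtype.ext h ▸ hw')
    have hui : f u.1 = i := congrArg Fin.val u.2
    have hwi : f w.1 = i := congrArg Fin.val w.2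
    have hik := i.2
    generalize Subtype.val '' D = E at hD' huD hwD
    have hQ : Q (k + 1) := by
      -- The lower part of fibre i keeps its index; its upper part and all later fibres move up by
      -- one.
      refine ⟨fun x => if f x < i then f x else if f x = i ∧ x ∈ E then i else f x + 1,
        fun x y hxy => ?_, fun x => ?_, fun j hj => ?_⟩
      · by_cases hfxy : f x < f y
        · exact hf x y hfxy
        have h2 := hD' x y
        by_cases hxE : x ∈ E <;> by_cases hyE : y ∈ E <;>
          simp only [hxE, hyE, and_true, and_false, if_false, not_false_eq_true,
            not_true_eq_false, true_imp_iff] at h2 hxy <;>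
          split_ifs at hxy <;> first | exact h2 (by omega) (by omega) | omega
      · have := hlt x
        dsimp only
        split_ifs <;> omega
      · rcases lt_trichotomy j i with hji | rfl | hji
        · obtain ⟨x, hx⟩ := hsurj j (by omega)
          exact ⟨x, by simp [hx, hji]⟩
        · exact ⟨u.1, by simp [hui, huD]⟩
        · by_cases hj' : j = i + 1
          · exact ⟨w.1, by simp [hwi, hwD, hj']⟩
          · obtain ⟨x, hx⟩ := hsurj (j - 1) (by omega)
            refine ⟨x, ?_⟩
            dsimp only
            rw [if_neg (by omega), if_neg (by omega)]
            omega
    have := hmax _ hQ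
    omega

theorem ssd_eq_ncard_ordinalCuts [Finite α] : ssd α = (ordinalCuts α).ncard := by
  obtain ⟨k, f, hf⟩ := exists_isOrdinalSumDecomposition α
  have : {k | ∃ f : α → Fin k, IsOrdinalSumDecomposition f} = {(ordinalCuts α).ncard} := by
    ext j
    constructor
    · rintro ⟨f, hf⟩
      exact hf.eq_ncard_ordinalCuts
    · rintro rfl
      exact hf.eq_ncard_ordinalCuts ▸ ⟨f, hf⟩
  rw [ssd, this, csSup_singleton]

/-- In the forest picture two elements are incomparable exactly when one is a proper ancestor of the
other. The roots form a maximal chain, and every maximal chain meets every tree, so none is shorter.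
-/
theorem Codes.smc_eq {v : α ≃ Fin n} {e : ℕ → ℕ} (h : Codes v e) (he : IsNoncrossing n e) :
    smc α = cutC n e := by
  have hfin : Finite α := Finite.of_equiv _ v.symm
  have hroots : {x : α | ∀ y < (v x : ℕ), e y ≤ v x}.ncard = cutC n e := by
    rw [cutC, ← card_subtype_eq_card_filter v]
    rfl
  have hcomp : ∀ x y : α, (∀ z < (v x : ℕ), e z ≤ v x) → (v y : ℕ) < v x → y < x :=
    fun x y hx hy => (h.lt_iff _ _).2 (hx _ hy)
  refine le_antisymm (Nat.sInf_le ⟨{x : α | ∀ y < (v x : ℕ), e y ≤ v x}, ⟨?_, ?_⟩, hroots⟩) ?_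
  · intro x hx y hy hxy
    rcases lt_trichotomy (v x) (v y) with hlt | heq | hlt
    · exact Or.inl (hcomp y x hy hlt).le
    · exact absurd (v.injective heq) hxy
    · exact Or.inr (hcomp x y hx hlt).le
  · intro t ht hsub
    refine hsub.antisymm fun z hz => ?_
    -- r is the root of the tree that contains z: the greatest cut not exceeding the label of z. If
    -- the tree ended before z, its end would be a later cut, by noncrossing.
    obtain ⟨r, hrz, hr, hmax⟩ : ∃ r ≤ (v z : ℕ), (∀ y < r, e y ≤ r) ∧
        ∀ s ≤ (v z : ℕ), r < s → ¬ ∀ y < s, e y ≤ s := by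
      classical
      refine ⟨Nat.findGreatest (fun r => ∀ y < r, e y ≤ r) (v z), Nat.findGreatest_le _,
        Nat.findGreatest_spec (P := fun r => ∀ y < r, e y ≤ r) (Nat.zero_le _) (by simp), ?_⟩
      intro s hs hlt
      exact Nat.findGreatest_is_greatest (P := fun r => ∀ y < r, e y ≤ r) hlt hs
    have hrn := hrz.trans_lt (v z).2
    have her : (v z : ℕ) < e r := by
      by_contra! hle
      refine hmax (e r) hle (h.valid.lt hrn) fun y hy => ?_
      rcases lt_trichotomy y r with hyr | rfl | hyr
      · exact (hr y hyr).trans (h.valid.lt hrn).le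
      · exact le_rfl
      · exact he.2 r y hyr hy
    have hrt : v.symm ⟨r, hrn⟩ ∈ t := hsub (by simpa using hr)
    by_cases heq : v.symm ⟨r, hrn⟩ = z
    · rw [← heq]
      simpa using hr
    · exfalso
      have hne : r ≠ v z := fun h => heq (by simp [h])
      rcases ht hrt hz heq with hle | hle
      · have := (h.le_iff _ _).1 hle
        simp only [Equiv.apply_symm_apply] at this
        omega
      · have := (h.le_iff _ _).1 hle
        have := h.valid.lt (v z).2
        simp only [Equiv.apply_symm_apply] at *
        omega
  · refine le_csInf ?_ ?_
    · obtain ⟨s, hs, -⟩ := (IsChain.empty (α := α) (r := (· ≤ ·))).exists_maxChain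
      exact ⟨_, s, hs, rfl⟩
    · rintro k ⟨s, hs, rfl⟩
      -- A chain that misses the tree of the root x has only elements comparable with x; maximality
      -- would then put x into it.
      have hlayer : ∀ x : α, (∀ y < (v x : ℕ), e y ≤ v x) →
          ∃ z ∈ s, (v x : ℕ) ≤ v z ∧ (v z : ℕ) < e (v x) := by
        intro x hx
        by_contra! hcon
        have hins : IsChain (· ≤ ·) (insert x s) := by
          refine hs.1.insert fun z hz hne => ?_
          rcases lt_or_ge (v z : ℕ) (v x) with hlt | hge
          · exact Or.inr (hcomp x z hx hlt).le
          · exact Or.inl ((h.lt_iff _ _).2 (hcon z hz hge)).le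
        have hxs : x ∈ s := by
          rw [hs.2 hins (Set.subset_insert _ _)]
          exact Set.mem_insert _ _
        have h1 := hcon x hxs le_rfl
        have h2 := h.valid.lt (v x).2
        omega
      choose! φ hφ using hlayer
      rw [← hroots]
      refine Set.ncard_le_ncard_of_injOn φ (fun x hx => (hφ x hx).1) ?_
      -- Trees with different roots are disjoint, so the chosen representatives are distinct.
      have key : ∀ x y : α, (∀ z < (v x : ℕ), e z ≤ v x) → (∀ z < (v y : ℕ), e z ≤ v y) →
          φ x = φ y → (v x : ℕ) ≤ v y := by
        intro x y hx hy hxy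
        by_contra! hlt
        have h1 := (hφ x hx).2.1
        have h2 := (hφ y hy).2.2
        have h3 := hx _ hlt
        rw [hxy] at h1
        omega
      intro x hx y hy hxy
      exact v.injective (Fin.ext (le_antisymm (key x y hx hy hxy) (key y x hy hx hxy.symm)))

end Poset

/-! ### The two classes of posets -/

/-- As a tie-breaking key this puts larger up-sets first, so codes increase weakly on ties; the cast
`Nat.cast` makes them decrease weakly. -/
def negCast (u : ℕ) : ℤ := -(u : ℤ)

theorem negCast_injective : Function.Injective negCast := fun a b h => by
  simpa [negCast] using h

theorem Valid.negCast_le_iff {n : ℕ} {e : ℕ → ℕ} (h : Valid n e) (x y : ℕ) :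
    negCast (n - e x) ≤ negCast (n - e y) ↔ e x ≤ e y := by
  have h1 := h.le x
  have h2 := h.le y
  simp only [negCast]
  omega

/-- A descent e y < e x with x < y cannot be a tie, so some z lies below y but not below x. Then z,
y, e y is a chain and x is incomparable to all of it. -/
theorem isMono_iff {n : ℕ} {e : ℕ → ℕ} :
    IsMono n e ↔ Valid n e ∧ TieSorted negCast n e ∧ ¬ HasThreePlusOne n e := by
  constructor
  · refine fun h => ⟨h.1, fun x y hxy hy _ => (h.1.negCast_le_iff x y).2 (h.2 x y hxy hy), ?_⟩
    rintro ⟨a, b, c, d, hb, hc, h1, h2, h3, h4, hd⟩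
    have := h.2 d b (by omega) hb
    omega
  · refine fun ⟨hv, ht, hno⟩ => ⟨hv, fun x y hxy hy => ?_⟩
    by_contra! hlt
    have hz : ¬ ∀ z < n, x < e z → y < e z := fun hz =>
      hlt.not_ge ((hv.negCast_le_iff x y).1 (ht x y hxy hy hz))
    push Not at hz
    obtain ⟨z, hz, hxz, hzy⟩ := hz
    exact hno ⟨z, y, e y, x, hy, hlt.trans_le (hv.le x), hxz, hzy, le_rfl, hlt, hxy.trans hy⟩

/-- A crossing x < y < e x < e y cannot be a tie, so some z lies below y but not below x. Then z, x,
y, e x, in the roles a, b, c, d, form an N. -/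
theorem isNoncrossing_iff {n : ℕ} {e : ℕ → ℕ} :
    IsNoncrossing n e ↔ Valid n e ∧ TieSorted Nat.cast n e ∧ ¬ HasN n e := by
  have key : Valid n e → ∀ x y, ((n - e x : ℕ) : ℤ) ≤ (n - e y : ℕ) ↔ e y ≤ e x := by
    intro hv x y
    have h1 := hv.le x
    have h2 := hv.le y
    omega
  constructor
  · refine fun h => ⟨h.1, fun x y hxy hy hz => (key h.1 x y).2 (h.2 x y hxy ?_), ?_⟩
    · exact hz x (hxy.trans hy) (h.1.lt (hxy.trans hy))
    · rintro ⟨a, b, c, d, hd, h1, h2, h3, h4, h5⟩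
      have := h.2 b c (by omega) h3
      omega
  · refine fun ⟨hv, ht, hno⟩ => ⟨hv, fun x y hxy hy => ?_⟩
    by_contra! hlt
    have hyn := hy.trans_le (hv.le x)
    have hz : ¬ ∀ z < n, x < e z → y < e z := fun hz =>
      hlt.not_ge ((key hv x y).1 (ht x y hxy hyn hz))
    push Not at hz
    obtain ⟨z, hz, hxz, hzy⟩ := hz
    exact hno ⟨z, x, y, e x, hlt.trans_le (hv.le y), hxz, hzy, hy, le_rfl, hlt⟩

/-! ### From codes to isomorphism classes -/

/-- The poset on `{0, …, n - 1}` encoded by `e`. -/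
abbrev Valid.partialOrder {n : ℕ} {e : ℕ → ℕ} (h : Valid n e) : PartialOrder (Fin n) where
  le x y := x = y ∨ e x ≤ y
  lt x y := e x ≤ y
  le_refl x := Or.inl rfl
  le_trans x y z := by
    rintro (rfl | h1) (rfl | h2)
    · exact Or.inl rfl
    · exact Or.inr h2
    · exact Or.inr h1
    · exact Or.inr (h1.trans ((h.lt y.2).le.trans h2))
  lt_iff_le_not_ge x y := by
    have h1 := h.lt x.2
    have h2 := h.lt y.2
    constructor
    · refine fun hxy => ⟨Or.inr hxy, ?_⟩
      rintro (rfl | h3) <;> omega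
    · rintro ⟨rfl | h3, h4⟩
      · exact absurd (Or.inl rfl) h4
      · exact h3
  le_antisymm x y := by
    have h1 := h.lt x.2
    have h2 := h.lt y.2
    rintro (rfl | h3) (h4 | h4)
    · rfl
    · rfl
    · exact h4.symm
    · omega

theorem Valid.codes {n : ℕ} {e : ℕ → ℕ} (h : Valid n e) :
    @Codes (Fin n) h.partialOrder n (Equiv.refl _) e :=
  @Codes.mk (Fin n) h.partialOrder n (Equiv.refl _) e h fun _ _ => Iff.rfl

/-- The isomorphism class of the poset encoded by `e`. -/
def Valid.posetClass {n : ℕ} {e : ℕ → ℕ} (h : Valid n e) : PosetClass n :=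
  Quotient.mk (posetSetoid n) h.partialOrder

theorem Valid.ssd_posetClass {n : ℕ} {e : ℕ → ℕ} (h : Valid n e) :
    h.posetClass.ssd = cutC n e :=
  (@ssd_eq_ncard_ordinalCuts (Fin n) h.partialOrder _).trans
    (@Codes.ncard_ordinalCuts (Fin n) h.partialOrder _ _ _ h.codes)

theorem Valid.minCount_posetClass {n : ℕ} {e : ℕ → ℕ} (h : Valid n e) :
    h.posetClass.minCount = minC n e :=
  @Codes.minCount_eq (Fin n) h.partialOrder _ _ _ h.codes

/-- Tie-sorted codes are unique representatives of the isomorphism classes. The second statistic is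
a parameter so that both `ssd` and `smc` can be transported. -/
theorem genFun_posetAvoiding {Q : Type} [PartialOrder Q] {g : ℕ → ℤ} (hg : Function.Injective g)
    {H : ℕ → (ℕ → ℕ) → Prop} {P : ℕ → (ℕ → ℕ) → Prop} [∀ n, Finite {e // P n e}]
    (hP : ∀ n e, P n e ↔ Valid n e ∧ TieSorted g n e ∧ ¬ H n e)
    (hH : ∀ n e (h : Valid n e), @IsFreeOf (Fin n) h.partialOrder Q _ ↔ ¬ H n e)
    (stat : ∀ n, PosetClass n → ℕ)
    (hstat : ∀ n e (h : P n e), stat n ((hP n e).1 h).1.posetClass = cutC n e) :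
    genFun (PosetAvoiding Q) (fun _ p => p.1.minCount) (fun n p => stat n p.1) =
      genFun (fun n => {e // P n e}) (fun n e => minC n e.1) (fun n e => cutC n e.1) := by
  have hfree : ∀ n e (h : P n e), ((hP n e).1 h).1.posetClass.IsFreeOf TwoPlusTwo ∧
      ((hP n e).1 h).1.posetClass.IsFreeOf Q := fun n e h =>
    ⟨@Codes.isFreeOf_twoPlusTwo (Fin n) ((hP n e).1 h).1.partialOrder n _ _ (Valid.codes _),
      (hH n e ((hP n e).1 h).1).2 ((hP n e).1 h).2.2⟩
  refine (genFun_congr (T := fun n => {e // P n e}) (S := PosetAvoiding Q)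
    (fun n e => ⟨((hP n e.1).1 e.2).1.posetClass, hfree n e.1 e.2⟩)
    (fun n => ⟨?_, ?_⟩) (fun n e => Valid.minCount_posetClass _) fun n e => hstat n e.1 e.2).symm
  · rintro ⟨e, he⟩ ⟨e', he'⟩ h
    obtain ⟨f⟩ : Nonempty (@OrderIso (Fin n) (Fin n) ((hP n e).1 he).1.partialOrder.toLE
        ((hP n e').1 he').1.partialOrder.toLE) := Quotient.exact (congrArg Subtype.val h)
    refine Subtype.ext (@Codes.eq_of_tieSorted (Fin n) ((hP n e).1 he).1.partialOrder n g hg _ _ _ _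
      (Valid.codes _) (@Codes.congr (Fin n) (Fin n) ((hP n e').1 he').1.partialOrder
        ((hP n e).1 he).1.partialOrder n _ _ (Valid.codes _) f) ((hP n e).1 he).2.1
        ((hP n e').1 he').2.1)
  · rintro ⟨p, hp⟩
    obtain ⟨R, rfl⟩ := Quotient.exists_rep p
    obtain ⟨v, e, hc, ht⟩ := @exists_codes (Fin n) R n g (Equiv.refl _) hp.1
    have hiso : Nonempty (@OrderIso (Fin n) (Fin n) hc.valid.partialOrder.toLE R.toLE) :=
      ⟨{ toEquiv := v.symm
         map_rel_iff' := by
          intro a b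
          refine (@Codes.le_iff (Fin n) R n v e hc _ _).trans ?_
          rw [Equiv.apply_symm_apply, Equiv.apply_symm_apply, ← Fin.ext_iff]
          rfl }⟩
    have hclass : hc.valid.posetClass = Quotient.mk (posetSetoid n) R := Quotient.sound hiso
    have hfree : @IsFreeOf (Fin n) hc.valid.partialOrder Q _ := by
      have := hp.2
      rw [← hclass] at this
      exact this
    exact ⟨⟨e, (hP n e).2 ⟨hc.valid, ht, (hH n e _).1 hfree⟩⟩, Subtype.ext hclass⟩

theorem genPosetThreePlusOne_eq : genPosetThreePlusOne =
    genFun (fun n => {e // IsMono n e}) (fun n e => minC n e.1) (fun n e => cutC n e.1) :=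
  genFun_posetAvoiding negCast_injective (fun _ _ => isMono_iff)
    (fun n _ h => @Codes.isFreeOf_threePlusOne_iff (Fin n) h.partialOrder n _ _ h.codes)
    (fun _ p => p.ssd) fun _ _ _ => Valid.ssd_posetClass _

theorem genPosetN_eq : genPosetN =
    genFun (fun n => {e // IsNoncrossing n e}) (fun n e => minC n e.1) (fun n e => cutC n e.1) :=
  genFun_posetAvoiding Nat.cast_injective (fun _ _ => isNoncrossing_iff)
    (fun n _ h => @Codes.isFreeOf_posetN_iff (Fin n) h.partialOrder n _ _ h.codes)
    (fun _ p => p.smc) fun n _ h => @Codes.smc_eq (Fin n) h.1.partialOrder n _ _ h.1.codes h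

/-- The functions that encode the Stoimenow matchings without the second pattern. -/
def IsSortedNFree (n : ℕ) (e : ℕ → ℕ) : Prop :=
  Valid n e ∧ TieSorted negCast n e ∧ ¬ HasN n e

instance (n : ℕ) : Finite {e // IsSortedNFree n e} :=
  finite_subtype_of_bounded n fun _ h => ⟨fun x _ => h.1.le x, h.1.2⟩

/-- Both sides count the N-free classes by the pair (min, ssd), through the two opposite tie orders.
The statistic `ssd` serves here because it equals `cutC` for every valid code, whereas `smc` needs
the noncrossing one. -/
theorem genFun_isSortedNFree :
    genFun (fun n => {e // IsSortedNFree n e}) (fun n e => minC n e.1) (fun n e => cutC n e.1) =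
    genFun (fun n => {e // IsNoncrossing n e}) (fun n e => minC n e.1) (fun n e => cutC n e.1) := by
  have h := fun n (e : ℕ → ℕ) (h : Valid n e) =>
    @Codes.isFreeOf_posetN_iff (Fin n) h.partialOrder n _ _ h.codes
  exact (genFun_posetAvoiding negCast_injective (P := IsSortedNFree) (fun _ _ => Iff.rfl) h
    (fun _ p => p.ssd) fun _ _ _ => Valid.ssd_posetClass _).symm.trans
    (genFun_posetAvoiding Nat.cast_injective (fun _ _ => isNoncrossing_iff) h
    (fun _ p => p.ssd) fun _ _ _ => Valid.ssd_posetClass _)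

/-! ### Ascent sequences that avoid `101` -/

theorem containsPattern_101_iff {n : ℕ} (w : Fin n → ℕ) :
    ContainsPattern w ![1, 0, 1] ↔ ∃ i j k, i < j ∧ j < k ∧ w i = w k ∧ w j < w i := by
  constructor
  · rintro ⟨f, hf⟩
    refine ⟨f 0, f 1, f 2, by simp, by simp, ?_, ?_⟩
    · have h1 := hf 0 2
      have h2 := hf 2 0
      simp at h1 h2
      omega
    · simpa using hf 1 0
  · rintro ⟨i, j, k, hij, hjk, h1, h2⟩
    have hm : StrictMono ![i, j, k] := by
      refine Fin.strictMono_iff_lt_succ.2 fun a => ?_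
      fin_cases a <;> simpa
    refine ⟨OrderEmbedding.ofStrictMono _ hm, fun a b => ?_⟩
    fin_cases a <;> fin_cases b <;> simp <;> omega

/-- The positions of the ascent tops that precede position `x`. -/
def ascentTops (α : ℕ → ℕ) (x : ℕ) : Finset ℕ :=
  (Finset.range x).filter fun k => 0 < k ∧ α (k - 1) < α k

theorem ascBefore_eq {n : ℕ} (α : ℕ → ℕ) (i : Fin n) :
    ascBefore (fun j : Fin n => α j) i = (ascentTops α i).card := by
  have h1 : ((Finset.range n).filter fun k => k < (i : ℕ) ∧ 0 < k ∧ α (k - 1) < α k) =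
      ascentTops α i := by
    ext k
    simp only [ascentTops, Finset.mem_filter, Finset.mem_range]
    have := i.2
    constructor
    · exact fun h => h.2
    · exact fun h => ⟨h.1.trans this, h⟩
  rw [← h1, ← card_subtype_eq_card_filter (Equiv.refl (Fin n))]
  refine Nat.card_congr (Equiv.subtypeEquivRight fun k => and_congr Iff.rfl ?_)
  constructor
  · rintro ⟨j, hj, hlt⟩
    refine ⟨by simp [hj], ?_⟩
    have hlt' : α j < α k := hlt
    simp only [Equiv.refl_apply]
    rw [hj] at hlt' ⊢
    simpa using hlt'
  · rintro ⟨hpos, hlt⟩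
    simp only [Equiv.refl_apply] at hpos hlt
    exact ⟨⟨k - 1, by omega⟩, by simp only; omega, hlt⟩

/-- If v has not occurred, restricted growth keeps all earlier letters below v. Ascent tops are
positive and pairwise distinct: between two equal ones, the smaller letter just before the second
would produce 101. So at most v - 1 of them exist. -/
theorem card_ascentTops_lt {n x v : ℕ} {α : ℕ → ℕ} (hx : x < n) (hx0 : x ≠ 0) (h0 : α 0 = 0)
    (hrgf : ∀ y < x, ∀ v < α y, ∃ z < y, α z = v)
    (havoid : ∀ x y z, x < y → y < z → z < n → α x = α z → α x ≤ α y)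
    (hv : ∀ y < x, α y ≠ v) : (ascentTops α x).card < v := by
  have hv0 : v ≠ 0 := fun h => hv 0 (by omega) (h0.trans h.symm)
  have hmaps : ∀ k ∈ ascentTops α x, α k ∈ Finset.Ico 1 v := by
    intro k hk
    simp only [ascentTops, Finset.mem_filter, Finset.mem_range] at hk
    rw [Finset.mem_Ico]
    refine ⟨by omega, ?_⟩
    by_contra! hle
    rcases hle.lt_or_eq with hlt | heq
    · obtain ⟨z, hz, hzv⟩ := hrgf k hk.1 v hlt
      exact hv z (hz.trans hk.1) hzv
    · exact hv k hk.1 heq.symm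
  have key : ∀ k ∈ ascentTops α x, ∀ l ∈ ascentTops α x, α k = α l → ¬ k < l := by
    intro k hk l hl hkl hlt
    simp only [ascentTops, Finset.mem_filter, Finset.mem_range] at hk hl
    rcases Nat.lt_or_ge k (l - 1) with h | h
    · have := havoid k (l - 1) l h (by omega) (by omega) hkl
      omega
    · have : l - 1 = k := by omega
      rw [this] at hl
      omega
  have := Finset.card_le_card_of_injOn α hmaps fun k hk l hl hkl =>
    le_antisymm (not_lt.1 (key l hl k hk hkl.symm)) (not_lt.1 (key k hk l hl hkl))
  rw [Nat.card_Ico] at this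
  omega

/-- The first occurrence of each value v with 1 ≤ v < α x is an ascent top: a larger letter just
before it would force an even earlier v. -/
theorem IsRGF.le_card_ascentTops {n x : ℕ} {α : ℕ → ℕ} (h : IsRGF n α) (hx : x < n) :
    α x ≤ 1 + (ascentTops α x).card := by
  classical
  have hsub : Finset.Ico 1 (α x) ⊆ (ascentTops α x).image α := by
    intro v hv
    rw [Finset.mem_Ico] at hv
    have hex := h.1 x hx v hv.2
    obtain ⟨hy, hyv⟩ := Nat.find_spec hex
    have hmin := fun z => Nat.find_min (m := z) hex
    set y := Nat.find hex
    have hy0 : y ≠ 0 := by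
      intro hy0
      have := h.le y (by omega)
      omega
    refine Finset.mem_image.2 ⟨y, ?_, hyv⟩
    simp only [ascentTops, Finset.mem_filter, Finset.mem_range]
    refine ⟨hy, by omega, ?_⟩
    by_contra! hle
    rcases hle.lt_or_eq with hlt | heq
    · obtain ⟨z, hz, hzv⟩ := h.1 (y - 1) (by omega) (α y) hlt
      exact hmin z (by omega) ⟨by omega, hzv.trans hyv⟩
    · exact hmin (y - 1) (by omega) ⟨by omega, heq.symm.trans hyv⟩
  have h1 := (Finset.card_le_card hsub).trans Finset.card_image_le
  rw [Nat.card_Ico] at h1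
  omega

theorem isRGF_iff {n : ℕ} {α : ℕ → ℕ} (hα : ∀ x, n ≤ x → α x = 0) :
    IsRGF n α ↔ IsAscentSequence (fun i : Fin n => α i) ∧
      ¬ ContainsPattern (fun i : Fin n => α i) ![1, 0, 1] := by
  have havoid : ¬ ContainsPattern (fun i : Fin n => α i) ![1, 0, 1] ↔
      ∀ x y z, x < y → y < z → z < n → α x = α z → α x ≤ α y := by
    rw [containsPattern_101_iff]
    constructor
    · intro h x y z hxy hyz hz heq
      by_contra! hlt
      exact h ⟨⟨x, by omega⟩, ⟨y, by omega⟩, ⟨z, hz⟩, hxy, hyz, heq, hlt⟩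
    · rintro h ⟨i, j, k, hij, hjk, heq, hlt⟩
      exact hlt.not_ge (h i j k hij hjk k.2 heq)
  rw [havoid]
  constructor
  · refine fun h => ⟨fun i => ⟨fun hi => ?_, fun _ => ?_⟩, h.2.1⟩
    · have := h.le i i.2
      dsimp only
      omega
    · rw [ascBefore_eq]
      exact h.le_card_ascentTops i.2
  · rintro ⟨hasc, hav⟩
    refine ⟨fun x => ?_, hav, hα⟩
    induction x using Nat.strong_induction_on with
    | _ x ih =>
      intro hx v hv
      by_contra! hno
      rcases Nat.eq_zero_or_pos x with rfl | hx0
      · have := (hasc ⟨0, hx⟩).1 rfl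
        dsimp only at this
        omega
      · have h0 := (hasc ⟨0, by omega⟩).1 rfl
        have h1 := (hasc ⟨x, hx⟩).2 hx0.ne'
        -- A skipped value v < α x would give α x ≤ 1 + asc ≤ v.
        have h2 := card_ascentTops_lt hx hx0.ne' h0 (fun y hy => ih y hy (hy.trans hx)) hav hno
        rw [ascBefore_eq] at h1
        dsimp only at h1
        omega

theorem genAscent_eq : genAscent =
    genFun (fun n => {α // IsRGF n α}) (fun n α => zeroC n α.1) (fun n α => rminC n α.1) := by
  refine (genFun_congr (T := fun n => {α // IsRGF n α}) (S := AscentAvoiding ![1, 0, 1])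
    (fun n α => ⟨fun i => α.1 i, (isRGF_iff α.2.2.2).1 α.2⟩) (fun n => ⟨?_, ?_⟩)
    (fun n α => ?_) fun n α => ?_).symm
  · rintro ⟨α, hα⟩ ⟨β, hβ⟩ h
    refine Subtype.ext (funext fun x => ?_)
    by_cases hx : x < n
    · exact congrFun (congrArg Subtype.val h) ⟨x, hx⟩
    · exact (hα.2.2 x (not_lt.1 hx)).trans (hβ.2.2 x (not_lt.1 hx)).symm
  · rintro ⟨w, hw⟩
    let α : ℕ → ℕ := fun x => if hx : x < n then w ⟨x, hx⟩ else 0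
    have hα : (fun i : Fin n => α i) = w := by
      funext i
      simp [α]
    refine ⟨⟨α, (isRGF_iff fun x hx => by simp [α, not_lt.2 hx]).2 ?_⟩, Subtype.ext hα⟩
    rwa [hα]
  · exact card_subtype_eq_card_filter (Equiv.refl (Fin n)) fun x => α.1 x = 0
  · rw [rminC, ← card_subtype_eq_card_filter (Equiv.refl (Fin n))]
    refine Nat.card_congr (Equiv.subtypeEquivRight fun i => ?_)
    exact ⟨fun h y hy hiy => h ⟨y, hy⟩ hiy, fun h j hj => h j j.2 hj⟩

/-! ### Fishburn permutations that avoid `3142` -/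

/-- The permutation has no subsequence order-isomorphic to `231`. -/
def Avoids231 {n : ℕ} (π : Equiv.Perm (Fin n)) : Prop :=
  ∀ i j k, i < j → j < k → π k < π i → π j < π i

/-- Both forbidden configurations contain 231. Conversely, an occurrence of 231 can be moved so that
its "2" and "1" are consecutive values; the entry right after the "2" then gives the Fishburn
pattern if it is larger, and 3142 if it is smaller. -/
theorem isFishburn_and_not_containsPattern_iff {n : ℕ} (π : Equiv.Perm (Fin n)) :
    IsFishburn π ∧ ¬ ContainsPattern π ![3, 1, 4, 2] ↔ Avoids231 π := by
  constructor
  · rintro ⟨hF, hP⟩ i j k hij hjk hki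
    by_contra! hlt
    have hij' : π i < π j := lt_of_le_of_ne hlt (π.injective.ne hij.ne)
    classical
    -- m is the least value above π k that occurs before position j. By minimality, the value m - 1
    -- occurs after j.
    have hex : ∃ m : ℕ, ∃ p < j, (π p : ℕ) = m ∧ (π k : ℕ) < m := ⟨_, i, hij, rfl, hki⟩
    have hle : Nat.find hex ≤ π i := Nat.find_min' hex ⟨i, hij, rfl, hki⟩
    obtain ⟨p, hpj, hpm, hkm⟩ := Nat.find_spec hex
    have hmin := fun z => Nat.find_min (m := z) hex
    set m := Nat.find hex
    obtain ⟨q, hq⟩ := π.surjective ⟨m - 1, by omega⟩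
    have hqv : (π q : ℕ) + 1 = m := by
      rw [hq]
      simp only
      omega
    have hjq : j < q := by
      rcases lt_trichotomy q j with h | h | h
      · exfalso
        by_cases hkq : q = k
        · exact absurd (hkq ▸ h) hjk.not_gt
        · have hne : (π q : ℕ) ≠ π k := fun h => hkq (π.injective (Fin.ext h))
          exact hmin (π q) (by omega) ⟨q, h, rfl, by omega⟩
      · subst h
        have : (π i : ℕ) < π q := hij'
        omega
      · exact h
    have hpjv : (π p : ℕ) < π j := by
      have : (π i : ℕ) < π j := hij'
      omega
    let p' : Fin n := ⟨p + 1, by omega⟩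
    have hp'j : p' ≤ j := hpj
    have hp'q : p' < q := hp'j.trans_lt hjq
    rcases lt_trichotomy (π p) (π p') with h | h | h
    · exact hF ⟨p, p', q, rfl, hp'q, hqv.trans hpm.symm, h⟩
    · have := congrArg Fin.val (π.injective h)
      simp [p'] at this
    · have h' : (π p' : ℕ) < π p := h
      have hne : (π p' : ℕ) ≠ π q := fun h => hp'q.ne (π.injective (Fin.ext h))
      have hp'j' : p' < j := lt_of_le_of_ne hp'j fun h => by
        rw [h] at h'
        omega
      have hm : StrictMono ![p, p', j, q] := by
        refine Fin.strictMono_iff_lt_succ.2 fun a => ?_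
        have : p < p' := by simp [p', Fin.lt_def]
        fin_cases a <;> simpa
      refine hP ⟨OrderEmbedding.ofStrictMono _ hm, fun a b => ?_⟩
      rw [Fin.lt_def]
      fin_cases a <;> fin_cases b <;> simp [-Fin.val_fin_lt] <;> omega
  · refine fun h => ⟨?_, ?_⟩
    · rintro ⟨i, i', j, hi, hij, hv, hlt⟩
      refine hlt.not_gt (h i i' j (by rw [Fin.lt_def]; omega) hij ?_)
      rw [Fin.lt_def]
      omega
    · rintro ⟨f, hf⟩
      have h1 : π (f 3) < π (f 0) := (hf 3 0).1 (by simp)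
      have h2 : π (f 0) < π (f 2) := (hf 0 2).1 (by simp)
      exact h2.not_gt (h (f 0) (f 2) (f 3) (by simp) (by simp) h1)

/-- The elements after position `x` that are smaller than `π x` are those before position `e x`. -/
def PermCodes {n : ℕ} (π : Equiv.Perm (Fin n)) (e : ℕ → ℕ) : Prop :=
  Valid n e ∧ ∀ x y : Fin n, x < y → (π y < π x ↔ (y : ℕ) < e x)

/-- Take the position of the next greater entry, or n. A smaller entry beyond that position would
complete a 231. -/
theorem Avoids231.exists_permCodes {n : ℕ} {π : Equiv.Perm (Fin n)} (h : Avoids231 π) :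
    ∃ e, PermCodes π e := by
  have hex : ∀ x : Fin n, ∃ m : ℕ, (x < m ∧ m ≤ n) ∧
      ∀ y : Fin n, x < y → (π y < π x ↔ (y : ℕ) < m) := by
    classical
    intro x
    have hne : ∃ m : ℕ, x < m ∧ ∀ hm : m < n, π x < π ⟨m, hm⟩ :=
      ⟨n, x.2, fun h => absurd h (lt_irrefl n)⟩
    have hle : Nat.find hne ≤ n := Nat.find_min' hne ⟨x.2, fun h => absurd h (lt_irrefl n)⟩
    obtain ⟨hxm, hm⟩ := Nat.find_spec hne
    have hmin := fun z => Nat.find_min (m := z) hne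
    set m := Nat.find hne
    refine ⟨m, ⟨hxm, hle⟩, fun y hxy => ⟨fun hy => ?_, fun hy => ?_⟩⟩
    · by_contra! hmy
      have hmn : m < n := hmy.trans_lt y.2
      have h1 := hm hmn
      rcases hmy.lt_or_eq with hlt | heq
      · exact h1.not_gt (h x ⟨m, hmn⟩ y hxm hlt hy)
      · have : (⟨m, hmn⟩ : Fin n) = y := Fin.ext heq
        rw [this] at h1
        exact h1.not_gt hy
    · have h1 := hmin y hy
      simp only [not_and, not_forall, not_lt] at h1
      obtain ⟨_, h2⟩ := h1 hxy
      exact lt_of_le_of_ne h2 (π.injective.ne hxy.ne')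
  choose e he1 he2 using hex
  refine ⟨fun x => if hx : x < n then e ⟨x, hx⟩ else 0, ⟨fun x hx => ?_, fun x hx => ?_⟩,
    fun x y hxy => ?_⟩
  · simpa [hx] using he1 ⟨x, hx⟩
  · simp [not_lt.2 hx]
  · simpa using he2 x y hxy

theorem PermCodes.isNoncrossing {n : ℕ} {π : Equiv.Perm (Fin n)} {e : ℕ → ℕ}
    (h : PermCodes π e) : IsNoncrossing n e := by
  refine ⟨h.1, fun x y hxy hy => ?_⟩
  by_contra! hlt
  have hm : e x < n := hlt.trans_le (h.1.le y)
  have hyn : y < n := hy.trans hm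
  have h1 := (h.2 ⟨x, hxy.trans hyn⟩ ⟨y, hyn⟩ hxy).2 hy
  have h2 := (h.2 ⟨y, hyn⟩ ⟨e x, hm⟩ hy).2 hlt
  exact lt_irrefl _ ((h.2 ⟨x, hxy.trans hyn⟩ ⟨e x, hm⟩ (hxy.trans hy)).1 (h2.trans h1))

theorem Valid.ext {n : ℕ} {e e' : ℕ → ℕ} (h : Valid n e) (h' : Valid n e')
    (H : ∀ x y : Fin n, x < y → ((y : ℕ) < e x ↔ (y : ℕ) < e' x)) : e = e' := by
  have key : ∀ e e' : ℕ → ℕ, Valid n e → Valid n e' →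
      (∀ x y : Fin n, x < y → ((y : ℕ) < e x → (y : ℕ) < e' x)) → ∀ x, e x ≤ e' x := by
    intro e e' h h' H x
    by_cases hx : x < n
    · by_contra! hlt
      have := H ⟨x, hx⟩ ⟨e' x, hlt.trans_le (h.le x)⟩ (h'.lt hx) hlt
      exact lt_irrefl _ this
    · simp [h.2 x (not_lt.1 hx)]
  exact funext fun x => le_antisymm (key e e' h h' (fun x y hxy => (H x y hxy).1) x)
    (key e' e h' h (fun x y hxy => (H x y hxy).2) x)

/-- A bijection to `Fin m` is determined by the order that it induces. -/
theorem equiv_fin_eq_of_lt_iff {γ : Type} {m : ℕ} {p q : γ ≃ Fin m}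
    (h : ∀ x y, p x < p y ↔ q x < q y) : p = q := by
  have key : ∀ (p : γ ≃ Fin m) (x : γ), (p x : ℕ) = Nat.card {y : γ // p y < p x} := by
    intro p x
    rw [Nat.card_congr (p.subtypeEquiv (q := fun z => z < p x) fun y => Iff.rfl),
      Nat.card_eq_fintype_card, Fintype.card_of_subtype (Finset.Iio (p x)) (by simp), Fin.card_Iio]
  ext x
  rw [key p, key q]
  simp only [h]

/-- The code prescribes the comparison of any two entries. Noncrossing makes the prescribed relation
`r` transitive, hence a strict linear order, and ranks in this order are the values of the
permutation. -/
theorem IsNoncrossing.exists_permCodes {n : ℕ} {e : ℕ → ℕ} (h : IsNoncrossing n e) :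
    ∃ π : Equiv.Perm (Fin n), PermCodes π e := by
  classical
  let r : Fin n → Fin n → Prop := fun x y => (x < y ∧ e x ≤ y) ∨ (y < x ∧ (x : ℕ) < e y)
  have hirr : ∀ x, ¬ r x x := fun x => by simp [r]
  have htot : ∀ x y, x ≠ y → r x y ∨ r y x := fun x y hxy => by
    have : (x : ℕ) ≠ y := Fin.val_injective.ne hxy
    simp only [r, Fin.lt_def]
    omega
  have htrans : ∀ x y z, r x y → r y z → r x z := fun x y z => by
    have h1 := h.2 x y
    have h2 := h.2 x z
    have h3 := h.2 y x
    have h4 := h.2 y z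
    have h5 := h.2 z x
    have h6 := h.2 z y
    have h7 : (x : ℕ) = z → e x = e z := congrArg e
    have hx := h.1.lt x.2
    have hy := h.1.lt y.2
    have hz := h.1.lt z.2
    simp only [r, Fin.lt_def]
    omega
  let rank : Fin n → ℕ := fun x => (Finset.univ.filter fun y => r y x).card
  have hrank : ∀ x y, r x y → rank x < rank y := fun x y hxy => by
    refine Finset.card_lt_card (Finset.ssubset_iff_of_subset ?_ |>.2 ⟨x, ?_, ?_⟩)
    · intro z hz
      simp only [Finset.mem_filter, Finset.mem_univ, true_and] at hz ⊢
      exact htrans z x y hz hxy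
    · simpa using hxy
    · simpa using hirr x
  have hlt : ∀ x, rank x < n := fun x => by
    have : (Finset.univ.filter fun y => r y x) ⊂ Finset.univ :=
      Finset.ssubset_iff_of_subset (Finset.subset_univ _) |>.2 ⟨x, by simp, by simpa using hirr x⟩
    simpa using Finset.card_lt_card this
  have hinj : Function.Injective fun x => (⟨rank x, hlt x⟩ : Fin n) := fun x y hxy => by
    by_contra hne
    have heq : rank x = rank y := congrArg Fin.val hxy
    rcases htot x y hne with h | h
    · exact (hrank _ _ h).ne heq
    · exact (hrank _ _ h).ne' heq
  let π : Equiv.Perm (Fin n) := Equiv.ofBijective _ (Finite.injective_iff_bijective.1 hinj)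
  have hπ : ∀ x y, π x < π y ↔ r x y := fun x y => by
    refine ⟨fun hxy => ?_, fun hxy => hrank x y hxy⟩
    by_contra hno
    rcases eq_or_ne x y with rfl | hne
    · exact lt_irrefl _ hxy
    · exact lt_asymm hxy (show rank y < rank x from hrank y x ((htot x y hne).resolve_left hno))
  refine ⟨π, h.1, fun x y hxy => ?_⟩
  rw [hπ]
  simp only [r, Fin.lt_def] at hxy ⊢
  omega

theorem PermCodes.avoids231 {n : ℕ} {π : Equiv.Perm (Fin n)} {e : ℕ → ℕ} (h : PermCodes π e) :
    Avoids231 π := fun i j k hij hjk hki =>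
  (h.2 i j hij).2 (lt_trans hjk ((h.2 i k (hij.trans hjk)).1 hki))

theorem PermCodes.perm_eq {n : ℕ} {π π' : Equiv.Perm (Fin n)} {e : ℕ → ℕ} (h : PermCodes π e)
    (h' : PermCodes π' e) : π = π' := by
  refine equiv_fin_eq_of_lt_iff fun x y => ?_
  rcases lt_trichotomy x y with hxy | rfl | hxy
  · have h1 := (h.2 x y hxy).trans (h'.2 x y hxy).symm
    have h2 := π.injective.ne hxy.ne
    have h3 := π'.injective.ne hxy.ne
    rw [← not_iff_not, not_lt, not_lt, h2.symm.le_iff_lt, h3.symm.le_iff_lt]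
    exact h1
  · simp
  · exact (h.2 y x hxy).trans (h'.2 y x hxy).symm

theorem PermCodes.idr_eq {n : ℕ} {π : Equiv.Perm (Fin n)} {e : ℕ → ℕ} (h : PermCodes π e) :
    idr π = minC n e := by
  rw [minC, ← card_subtype_eq_card_filter (Equiv.refl (Fin n))]
  refine Nat.card_congr (Equiv.subtypeEquivRight fun i => ⟨fun hi x hx => ?_, fun hi => ?_⟩)
  · rcases lt_or_ge x (i : ℕ) with hxi | hxi
    · refine (h.2 ⟨x, hx⟩ i hxi).1 (hi ?_ ?_ hxi)
      · exact le_of_lt (show (⟨x, hx⟩ : Fin n) < i from hxi)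
      · exact le_refl i
    · exact hxi.trans_lt (h.1.lt hx)
  · intro a _ b hb hab
    exact (h.2 a b hab).2 (lt_of_le_of_lt (show (b : ℕ) ≤ i from hb) (hi a a.2))

theorem PermCodes.lmax_eq {n : ℕ} {π : Equiv.Perm (Fin n)} {e : ℕ → ℕ} (h : PermCodes π e) :
    lmax π = cutC n e := by
  rw [cutC, ← card_subtype_eq_card_filter (Equiv.refl (Fin n))]
  have key : ∀ x y : Fin n, x < y → (π x < π y ↔ e x ≤ y) := fun x y hxy => by
    rw [← not_iff_not, not_lt, not_le, (π.injective.ne hxy.ne').le_iff_lt]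
    exact h.2 x y hxy
  refine Nat.card_congr (Equiv.subtypeEquivRight fun i => ⟨fun hi y hy => ?_, fun hi j hj => ?_⟩)
  · exact (key ⟨y, hy.trans i.2⟩ i hy).1 (hi ⟨y, hy.trans i.2⟩ hy)
  · exact (key j i hj).2 (hi j hj)

theorem genFishburn_eq : genFishburn =
    genFun (fun n => {e // IsNoncrossing n e}) (fun n e => minC n e.1) (fun n e => cutC n e.1) := by
  choose φ hφ using fun n (e : {e // IsNoncrossing n e}) => e.2.exists_permCodes
  refine (genFun_congr (T := fun n => {e // IsNoncrossing n e}) (S := FishburnAvoiding ![3, 1, 4, 2])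
    (fun n e => ⟨φ n e, (isFishburn_and_not_containsPattern_iff _).2 (hφ n e).avoids231⟩)
    (fun n => ⟨?_, ?_⟩) (fun n e => (hφ n e).idr_eq) fun n e => (hφ n e).lmax_eq).symm
  · intro e e' h
    have h0 : φ n e = φ n e' := congrArg Subtype.val h
    have h1 := hφ n e
    rw [h0] at h1
    exact Subtype.ext (h1.1.ext (hφ n e').1 fun x y hxy =>
      (h1.2 x y hxy).symm.trans ((hφ n e').2 x y hxy))
  · rintro ⟨π, hπ⟩
    obtain ⟨e, he⟩ := ((isFishburn_and_not_containsPattern_iff π).1 hπ).exists_permCodes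
    exact ⟨⟨e, he.isNoncrossing⟩, Subtype.ext ((hφ n _).perm_eq he)⟩

/-! ### Matchings -/

theorem mem_iff_of_isLowerSet {n : ℕ} {S : Finset (Fin n)} (hS : IsLowerSet (S : Set (Fin n)))
    (y : Fin n) : y ∈ S ↔ (y : ℕ) < S.card := by
  constructor
  · intro hy
    have h1 : Finset.Iic y ⊆ S := fun z hz => hS (Finset.mem_Iic.1 hz) hy
    have h2 := Finset.card_le_card h1
    rw [Fin.card_Iic] at h2
    omega
  · intro hy
    by_contra hmem
    have h1 : S ⊆ Finset.Iio y := fun z hz => by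
      rw [Finset.mem_Iio]
      by_contra! hzy
      exact hmem (hS hzy hz)
    have h2 := Finset.card_le_card h1
    rw [Fin.card_Iio] at h2
    omega

theorem le_of_forall_step {m : ℕ} {β : Type} [Preorder β] {f : Fin m → β} {a b : Fin m}
    (hab : a ≤ b) (h : ∀ i j, a ≤ i → j ≤ b → (j : ℕ) = i + 1 → f i ≤ f j) : f a ≤ f b := by
  have key : ∀ d : ℕ, ∀ j : Fin m, (j : ℕ) = a + d → j ≤ b → f a ≤ f j := by
    intro d
    induction d with
    | zero =>
      intro j hj _
      rw [Fin.ext hj]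
    | succ d ih =>
      intro j hj hjb
      have hjb' : (j : ℕ) ≤ b := hjb
      refine (ih ⟨a + d, by omega⟩ rfl (Fin.le_def.2 (by simp only; omega))).trans
        (h _ j (Fin.le_def.2 (by simp)) hjb (by simp only; omega))
  exact key (b - a) b (by have : (a : ℕ) ≤ b := hab; omega) le_rfl

namespace Matching

variable {n : ℕ}

/-- The openers of `M` are `o 0 < o 1 < ⋯`, the closers are `c 0, c 1, …`, and the openers before the
closer `c x` are those with an index smaller than `e x`. -/
structure Codes (M : Matching n) (o c : Fin n → Fin (2 * n)) (e : ℕ → ℕ) : Prop where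
  valid : Valid n e
  strictMono : StrictMono o
  partner_eq : ∀ x, M.partner (o x) = c x
  lt_iff : ∀ x y, o y < c x ↔ (y : ℕ) < e x

section

variable {M : Matching n} {o c : Fin n → Fin (2 * n)} {e : ℕ → ℕ}

theorem Codes.lt (h : M.Codes o c e) (x : Fin n) : o x < c x := (h.lt_iff x x).2 (h.valid.lt x.2)

theorem Codes.partner_closer (h : M.Codes o c e) (x : Fin n) : M.partner (c x) = o x := by
  rw [← h.partner_eq, M.partner_partner]

theorem Codes.opener_ne_closer (h : M.Codes o c e) (x y : Fin n) : o x ≠ c y := fun heq => by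
  have h1 := h.lt x
  have h2 := h.lt y
  rw [← h.partner_eq x, heq, h.partner_closer] at h1
  exact lt_asymm h1 h2

theorem Codes.closer_injective (h : M.Codes o c e) : Function.Injective c := fun x y hxy =>
  h.strictMono.injective (by rw [← h.partner_closer, hxy, h.partner_closer])

theorem Codes.bijective (h : M.Codes o c e) : Function.Bijective (Sum.elim o c) := by
  refine (Fintype.bijective_iff_injective_and_card _).2 ⟨?_, by simp; omega⟩
  exact h.strictMono.injective.sumElim h.closer_injective h.opener_ne_closer

theorem Codes.exists_eq (h : M.Codes o c e) (p : Fin (2 * n)) :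
    (∃ x, o x = p) ∨ ∃ x, c x = p := by
  obtain ⟨x | x, hx⟩ := h.bijective.2 p
  · exact Or.inl ⟨x, hx⟩
  · exact Or.inr ⟨x, hx⟩

theorem Codes.exists_arc (h : M.Codes o c e) {a b : Fin (2 * n)} (hab : M.IsArc a b) :
    ∃ x, o x = a ∧ c x = b := by
  rcases h.exists_eq a with ⟨x, rfl⟩ | ⟨x, rfl⟩
  · exact ⟨x, rfl, by rw [← hab.2, h.partner_eq]⟩
  · have h1 := hab.1
    rw [← hab.2, h.partner_closer] at h1
    exact absurd h1 (h.lt x).not_gt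

theorem Codes.isOpener_iff (h : M.Codes o c e) (p : Fin (2 * n)) :
    M.IsOpener p ↔ ∃ x, o x = p := by
  constructor
  · intro hp
    obtain ⟨x, hx, -⟩ := h.exists_arc ⟨hp, rfl⟩
    exact ⟨x, hx⟩
  · rintro ⟨x, rfl⟩
    rw [IsOpener, h.partner_eq]
    exact h.lt x

theorem Codes.isCloser_iff (h : M.Codes o c e) (p : Fin (2 * n)) :
    M.IsCloser p ↔ ∃ x, c x = p := by
  constructor
  · intro hp
    obtain ⟨x, -, hx⟩ := h.exists_arc ⟨hp, M.partner_partner p⟩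
    exact ⟨x, hx⟩
  · rintro ⟨x, rfl⟩
    rw [IsCloser, h.partner_closer]
    exact h.lt x

theorem Codes.closer_lt_iff (h : M.Codes o c e) (x y : Fin n) : c x < o y ↔ e x ≤ y := by
  rw [← not_iff_not, not_lt, not_le, ← h.lt_iff, (h.opener_ne_closer y x).le_iff_lt]

theorem Codes.closer_lt_closer (h : M.Codes o c e) {x y : Fin n} (hxy : e x < e y) : c x < c y := by
  have hn := hxy.trans_le (h.valid.le y)
  exact ((h.closer_lt_iff x ⟨e x, hn⟩).2 le_rfl).trans ((h.lt_iff y ⟨e x, hn⟩).2 hxy)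

variable (M) in
theorem exists_codes : ∃ o c e, M.Codes o c e := by
  classical
  let S : Finset (Fin (2 * n)) := Finset.univ.filter fun a => a < M.partner a
  have hcompl : Sᶜ = S.image M.partner := by
    ext p
    simp only [S, Finset.compl_filter, Finset.mem_filter, Finset.mem_univ, true_and,
      Finset.mem_image, not_lt]
    constructor
    · intro hp
      refine ⟨M.partner p, ?_, M.partner_partner p⟩
      rw [M.partner_partner]
      exact lt_of_le_of_ne hp (M.partner_ne p)
    · rintro ⟨q, hq, rfl⟩
      rw [M.partner_partner]
      exact hq.le
  have hinj : Function.Injective M.partner := fun a b hab => by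
    rw [← M.partner_partner a, hab, M.partner_partner]
  have hS : S.card = n := by
    have h1 := Finset.card_compl S
    have h2 := Finset.card_le_univ S
    rw [hcompl, Finset.card_image_of_injective _ hinj] at h1
    simp only [Fintype.card_fin] at h1 h2
    omega
  let o : Fin n → Fin (2 * n) := S.orderEmbOfFin hS
  have ho : StrictMono o := (S.orderEmbOfFin hS).strictMono
  have hlt : ∀ x, o x < M.partner (o x) := fun x => by
    exact (Finset.mem_filter.1 (S.orderEmbOfFin_mem hS x)).2
  let e : ℕ → ℕ := fun x => if hx : x < n then
    (Finset.univ.filter fun y => o y < M.partner (o ⟨x, hx⟩)).card else 0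
  have he : ∀ x y : Fin n, o y < M.partner (o x) ↔ (y : ℕ) < e x := by
    intro x y
    have := mem_iff_of_isLowerSet (S := Finset.univ.filter fun y => o y < M.partner (o x)) (by
      intro a b hab ha
      simp only [Finset.coe_filter, Finset.mem_univ, true_and, Set.mem_ofPred_eq] at ha ⊢
      exact (ho.monotone hab).trans_lt ha) y
    simpa [e] using this
  refine ⟨o, fun x => M.partner (o x), e, ⟨⟨fun x hx => ⟨?_, ?_⟩, fun x hx => ?_⟩, ho,
    fun x => rfl, he⟩⟩
  · exact (he ⟨x, hx⟩ ⟨x, hx⟩).1 (hlt _)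
  · simp only [e, dif_pos hx]
    exact (Finset.card_le_univ _).trans (by simp)
  · simp [e, not_lt.2 hx]

theorem Codes.code_eq (h : M.Codes o c e) {o' c' : Fin n → Fin (2 * n)} {e' : ℕ → ℕ}
    (h' : M.Codes o' c' e') : e = e' := by
  have ho : o = o' := (h.strictMono.range_inj h'.strictMono).1 <| by
    ext p
    exact (h.isOpener_iff p).symm.trans (h'.isOpener_iff p)
  subst ho
  refine h.valid.ext h'.valid fun x y _ => ?_
  rw [← h.lt_iff, ← h'.lt_iff, ← h.partner_eq, ← h'.partner_eq]

/-- The closers are sorted by the number of the openers before them, and then by their openers. -/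
def ClosersSorted (c : Fin n → Fin (2 * n)) (e : ℕ → ℕ) : Prop :=
  ∀ x y : Fin n, x < y → e x = e y → c x < c y

/-- Equal values of `e` mean that no opener separates the two closers. In a run of consecutive
closers, the absence of Type II nestings makes the partners increase. -/
theorem Codes.closersSorted (h : M.Codes o c e) (hM : M.IsStoimenow) : ClosersSorted c e := by
  intro x y hxy he
  by_contra! hle
  have hle' : M.partner (c y) ≤ M.partner (c x) := by
    refine le_of_forall_step hle fun i j hi hj hij => ?_
    have hclos : ∀ p, c y ≤ p → p ≤ c x → ∃ z, c z = p := fun p hp1 hp2 => by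
      refine (h.exists_eq p).resolve_left ?_
      rintro ⟨z, rfl⟩
      have h1 := (h.lt_iff x z).1 (lt_of_le_of_ne hp2 (h.opener_ne_closer z x))
      have h2 := (h.lt_iff y z).not.1 (not_lt.2 hp1)
      omega
    have hlt : i < j := Fin.lt_def.2 (by omega)
    obtain ⟨u, rfl⟩ := hclos i hi (hlt.le.trans hj)
    obtain ⟨w, rfl⟩ := hclos j (hi.trans hlt.le) hj
    rw [h.partner_closer, h.partner_closer]
    by_contra! hcon
    exact hM.2 ⟨o w, o u, c u, c w, ⟨h.lt w, h.partner_eq w⟩, ⟨h.lt u, h.partner_eq u⟩, hij, hcon⟩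
  rw [h.partner_closer, h.partner_closer] at hle'
  exact hle'.not_gt (h.strictMono hxy)

/-- The tie hypothesis says that no closer separates the two openers. In a run of consecutive
openers, the absence of Type I nestings makes the closers increase. -/
theorem Codes.tieSorted (h : M.Codes o c e) (hM : M.IsStoimenow) : TieSorted negCast n e := by
  intro x y hxy hy hz
  rw [h.valid.negCast_le_iff]
  by_contra! hlt
  have hxn := hxy.trans hy
  have hxy' : o ⟨x, hxn⟩ ≤ o ⟨y, hy⟩ := h.strictMono.monotone (Fin.le_def.2 hxy.le)
  have hle : M.partner (o ⟨x, hxn⟩) ≤ M.partner (o ⟨y, hy⟩) := by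
    refine le_of_forall_step hxy' fun i j hi hj hij => ?_
    have hop : ∀ p, o ⟨x, hxn⟩ ≤ p → p ≤ o ⟨y, hy⟩ → ∃ z, o z = p := fun p hp1 hp2 => by
      refine (h.exists_eq p).resolve_right ?_
      rintro ⟨z, rfl⟩
      have h1 := (h.lt_iff z _).1 (lt_of_le_of_ne hp1 (h.opener_ne_closer _ z))
      have h2 := (h.closer_lt_iff z _).1 (lt_of_le_of_ne hp2 (h.opener_ne_closer _ z).symm)
      exact (hz z z.2 h1).not_ge h2
    have hlt : i < j := Fin.lt_def.2 (by omega)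
    obtain ⟨u, rfl⟩ := hop i hi (hlt.le.trans hj)
    obtain ⟨w, rfl⟩ := hop j (hi.trans hlt.le) hj
    rw [h.partner_eq, h.partner_eq]
    by_contra! hcon
    exact hM.1 ⟨o u, o w, c w, c u, ⟨h.lt u, h.partner_eq u⟩, ⟨h.lt w, h.partner_eq w⟩, hij, hcon⟩
  rw [h.partner_eq, h.partner_eq] at hle
  exact hle.not_gt (h.closer_lt_closer hlt)

theorem Codes.closer_lt_closer_iff (h : M.Codes o c e) (hc : ClosersSorted c e) (x y : Fin n) :
    c x < c y ↔ e x < e y ∨ (e x = e y ∧ x < y) := by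
  constructor
  · intro hxy
    rcases lt_trichotomy (e x) (e y) with h1 | h1 | h1
    · exact Or.inl h1
    · refine Or.inr ⟨h1, ?_⟩
      by_contra! hle
      rcases hle.lt_or_eq with hlt | rfl
      · exact lt_asymm hxy (hc y x hlt h1.symm)
      · exact lt_irrefl _ hxy
    · exact absurd hxy (h.closer_lt_closer h1).not_gt
  · rintro (h1 | ⟨h1, h2⟩)
    · exact h.closer_lt_closer h1
    · exact hc x y h2 h1

/-- The code fixes all comparisons between openers and closers, and sortedness those among closers;
so the linear order of all points is determined. -/
theorem Codes.eq_matching (h : M.Codes o c e) (hM : M.IsStoimenow) {M' : Matching n}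
    {o' c' : Fin n → Fin (2 * n)} (h' : M'.Codes o' c' e) (hM' : M'.IsStoimenow) : M = M' := by
  have heq : Equiv.ofBijective _ h.bijective = Equiv.ofBijective _ h'.bijective := by
    refine equiv_fin_eq_of_lt_iff fun x y => ?_
    rcases x with x | x <;> rcases y with y | y <;>
      simp only [Equiv.ofBijective_apply, Sum.elim_inl, Sum.elim_inr]
    · rw [h.strictMono.lt_iff_lt, h'.strictMono.lt_iff_lt]
    · rw [h.lt_iff, h'.lt_iff]
    · rw [h.closer_lt_iff, h'.closer_lt_iff]
    · rw [h.closer_lt_closer_iff (h.closersSorted hM),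
        h'.closer_lt_closer_iff (h'.closersSorted hM')]
  have ho : o = o' := funext fun x => by simpa using congrArg (fun f => f (Sum.inl x)) heq
  have hc : c = c' := funext fun x => by simpa using congrArg (fun f => f (Sum.inr x)) heq
  subst ho hc
  ext1
  funext p
  rcases h.exists_eq p with ⟨x, rfl⟩ | ⟨x, rfl⟩
  · rw [h.partner_eq, h'.partner_eq]
  · rw [h.partner_closer, h'.partner_closer]

theorem Codes.isStoimenow (h : M.Codes o c e) (hc : ClosersSorted c e)
    (ht : TieSorted negCast n e) : M.IsStoimenow := by
  constructor
  · rintro ⟨i, j, k, l, hil, hjk, hij, hkl⟩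
    obtain ⟨x, rfl, rfl⟩ := h.exists_arc hil
    obtain ⟨y, rfl, rfl⟩ := h.exists_arc hjk
    have hxy : x < y := h.strictMono.lt_iff_lt.1 (Fin.lt_def.2 (by omega))
    have h1 := (h.valid.negCast_le_iff _ _).1 (ht x y hxy y.2 fun z hz hxz => by
      by_contra! hzy
      have h1 := (h.lt_iff ⟨z, hz⟩ x).2 hxz
      have h2 := (h.closer_lt_iff ⟨z, hz⟩ y).2 hzy
      rw [Fin.lt_def] at h1 h2
      omega)
    refine hkl.not_gt ((h.closer_lt_closer_iff hc x y).2 ?_)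
    rcases h1.lt_or_eq with h1 | h1
    · exact Or.inl h1
    · exact Or.inr ⟨h1, hxy⟩
  · rintro ⟨k, l, i, j, hkj, hli, hij, hkl⟩
    obtain ⟨x, rfl, rfl⟩ := h.exists_arc hkj
    obtain ⟨y, rfl, rfl⟩ := h.exists_arc hli
    have hxy : x < y := h.strictMono.lt_iff_lt.1 hkl
    rcases (h.closer_lt_closer_iff hc y x).1 (Fin.lt_def.2 (by omega)) with h1 | h1
    · have hn := h1.trans_le (h.valid.le x)
      have h2 := (h.closer_lt_iff y ⟨e y, hn⟩).2 le_rfl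
      have h3 := (h.lt_iff x ⟨e y, hn⟩).2 h1
      rw [Fin.lt_def] at h2 h3
      omega
    · exact lt_asymm hxy h1.2

end

theorem exists_of_valid {e : ℕ → ℕ} (he : Valid n e) :
    ∃ (M : Matching n) (o c : Fin n → Fin (2 * n)), M.Codes o c e ∧ ClosersSorted c e := by
  classical
  -- The second coordinate n of an opener exceeds every closer's index, so in the tie e x = y the
  -- closer x precedes the opener y, as required.
  let key : Fin n ⊕ Fin n → ℕ ×ₗ ℕ :=
    Sum.elim (fun y => toLex ((y : ℕ), n)) fun x => toLex (e x, (x : ℕ))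
  have hkey : Function.Injective key := by
    refine Function.Injective.sumElim (fun x y hxy => ?_) (fun x y hxy => ?_) fun x y hxy => ?_
    · have := congrArg (fun p => (ofLex p).1) hxy
      exact Fin.ext this
    · have := congrArg (fun p => (ofLex p).2) hxy
      exact Fin.ext this
    · have : n = y := congrArg (fun p => (ofLex p).2) hxy
      have := y.2
      omega
  have hcard : (Finset.univ.image key).card = 2 * n := by
    rw [Finset.card_image_of_injective _ hkey]
    simp
    omega
  let ψ := (Finset.univ.image key).orderIsoOfFin hcard
  let pos : Fin n ⊕ Fin n → Fin (2 * n) := fun s =>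
    ψ.symm ⟨key s, Finset.mem_image_of_mem _ (Finset.mem_univ s)⟩
  have hpos : ∀ s t, pos s < pos t ↔ key s < key t := fun s t => by
    simp [pos]
  have hinj : Function.Injective pos := fun s t hst => hkey (by
    have := ψ.symm.injective hst
    exact congrArg Subtype.val this)
  have hbij : Function.Bijective pos :=
    (Fintype.bijective_iff_injective_and_card _).2 ⟨hinj, by simp; omega⟩
  let P := Equiv.ofBijective pos hbij
  let M : Matching n :=
    { partner := fun p => P (P.symm p).swap
      partner_partner := fun p => by simp
      partner_ne := fun p => by
        intro h
        have h1 : (P.symm p).swap = P.symm p := P.injective (by simpa using h)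
        cases hs : P.symm p <;> rw [hs] at h1 <;> simp at h1 }
  refine ⟨M, fun x => pos (Sum.inl x), fun x => pos (Sum.inr x), ⟨he, fun x y hxy => ?_,
    fun x => ?_, fun x y => ?_⟩, fun x y hxy hexy => ?_⟩
  · rw [hpos]
    simp only [key, Sum.elim_inl, Prod.Lex.toLex_lt_toLex]
    exact Or.inl hxy
  · change P (P.symm (P (Sum.inl x))).swap = P (Sum.inr x)
    simp
  · rw [hpos]
    simp only [key, Sum.elim_inl, Sum.elim_inr, Prod.Lex.toLex_lt_toLex]
    have := x.2
    omega
  · rw [hpos]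
    simp only [key, Sum.elim_inr, Prod.Lex.toLex_lt_toLex]
    exact Or.inr ⟨hexy, hxy⟩

section

variable {M : Matching n} {o c : Fin n → Fin (2 * n)} {e : ℕ → ℕ}

/-! #### Statistics -/

theorem Codes.bl_eq (h : M.Codes o c e) : M.bl = cutC n e := by
  have hcount : ∀ i, Nat.card {a : Fin (2 * n) // (a : ℕ) < 2 * i ∧ M.IsOpener a} =
        (Finset.univ.filter fun x => (o x : ℕ) < 2 * i).card ∧
      Nat.card {a : Fin (2 * n) // (a : ℕ) < 2 * i ∧ M.IsCloser a} =
        (Finset.univ.filter fun x => (c x : ℕ) < 2 * i).card := by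
    intro i
    have key : ∀ (f : Fin n → Fin (2 * n)) (Q : Fin (2 * n) → Prop), Function.Injective f →
        (∀ p, Q p ↔ ∃ x, f x = p) → Nat.card {a : Fin (2 * n) // (a : ℕ) < 2 * i ∧ Q a} =
        (Finset.univ.filter fun x => (f x : ℕ) < 2 * i).card := by
      intro f Q hf hQ
      rw [← Finset.card_image_of_injective _ hf]
      classical
      rw [Nat.card_eq_fintype_card]
      refine Fintype.card_of_subtype _ fun p => ?_
      simp only [Finset.mem_image, Finset.mem_filter, Finset.mem_univ, true_and, hQ]
      constructor
      · rintro ⟨x, hx, rfl⟩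
        exact ⟨hx, x, rfl⟩
      · rintro ⟨hp, x, rfl⟩
        exact ⟨x, hp, rfl⟩
    exact ⟨key o _ h.strictMono.injective h.isOpener_iff,
      key c _ h.closer_injective h.isCloser_iff⟩
  have htotal : ∀ m ≤ 2 * n, (Finset.univ.filter fun x => (o x : ℕ) < m).card +
      (Finset.univ.filter fun x => (c x : ℕ) < m).card = m := by
    intro m hm
    have h1 : (Finset.univ.filter fun s : Fin n ⊕ Fin n => ((Sum.elim o c s : Fin (2 * n)) : ℕ) < m).card = m := by
      have h2 : ((Finset.univ.filter fun s : Fin n ⊕ Fin n => ((Sum.elim o c s : Fin (2 * n)) : ℕ) < m).map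
          ⟨_, h.bijective.1⟩).map Fin.valEmbedding = Finset.range m := by
        ext p
        simp only [Finset.mem_map, Finset.mem_filter, Finset.mem_univ, true_and,
          Function.Embedding.coeFn_mk, Fin.valEmbedding_apply, Finset.mem_range]
        constructor
        · rintro ⟨_, ⟨s, hs, rfl⟩, rfl⟩
          exact hs
        · intro hp
          obtain ⟨s, hs⟩ := h.bijective.2 ⟨p, by omega⟩
          exact ⟨_, ⟨s, by rw [hs]; exact hp, hs⟩, rfl⟩
      rw [← Finset.card_map, ← Finset.card_map, h2, Finset.card_range]
    rwa [Finset.card_filter, Fintype.sum_sum_type, ← Finset.card_filter,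
      ← Finset.card_filter] at h1
  have hbal : ∀ i, 1 ≤ i → i ≤ n → (M.IsBalancedAt i ↔ ∀ y < i, e y ≤ i) := by
    intro i hi1 hin
    rw [IsBalancedAt, (hcount i).1, (hcount i).2]
    have hlow : ∀ x : Fin n, (o x : ℕ) < 2 * i ↔
        (x : ℕ) < (Finset.univ.filter fun x => (o x : ℕ) < 2 * i).card := fun x => by
      rw [← mem_iff_of_isLowerSet]
      · simp
      · intro a b hab ha
        simp only [Finset.coe_filter, Finset.mem_univ, true_and, Set.mem_ofPred_eq] at ha ⊢
        exact lt_of_le_of_lt (h.strictMono.monotone hab) ha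
    have htot := htotal (2 * i) (by omega)
    constructor
    · intro heq y hy
      have ho : (Finset.univ.filter fun x => (o x : ℕ) < 2 * i).card = i := by omega
      rw [ho] at hlow
      -- Every closed arc was opened before; in a balanced prefix the two sets have equal size, so
      -- its arcs are exactly those with index below i.
      have hsub : (Finset.univ.filter fun x => (c x : ℕ) < 2 * i) ⊆
          Finset.univ.filter fun x => (o x : ℕ) < 2 * i := fun x hx => by
        simp only [Finset.mem_filter, Finset.mem_univ, true_and] at hx ⊢
        exact lt_trans (h.lt x) hx
      have hset := Finset.eq_of_subset_of_card_le hsub heq.le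
      have hyc : (⟨y, by omega⟩ : Fin n) ∈ Finset.univ.filter fun x => (c x : ℕ) < 2 * i := by
        rw [hset]
        simpa [hlow] using hy
      rcases hin.lt_or_eq with hlt | rfl
      · refine (h.closer_lt_iff ⟨y, by omega⟩ ⟨i, hlt⟩).1 ?_
        have h1 := (hlow ⟨i, hlt⟩).not.2 (by simp)
        simp only [Finset.mem_filter, Finset.mem_univ, true_and] at hyc
        rw [Fin.lt_def]
        omega
      · exact h.valid.le y
    · intro hcut
      rcases hin.lt_or_eq with hlt | rfl
      · have h1 : (Finset.univ.filter fun x => (o x : ℕ) < o ⟨i, hlt⟩) = Finset.Iio ⟨i, hlt⟩ := by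
          ext x
          simp [h.strictMono.lt_iff_lt]
        have h2 : (Finset.univ.filter fun x => (c x : ℕ) < o ⟨i, hlt⟩) = Finset.Iio ⟨i, hlt⟩ := by
          ext x
          simp only [Finset.mem_filter, Finset.mem_univ, true_and, Finset.mem_Iio, Fin.val_fin_lt]
          rw [h.closer_lt_iff, Fin.lt_def]
          refine ⟨fun hx => (h.valid.lt x.2).trans_le hx, fun hx => hcut x hx⟩
        have h3 := htotal (o ⟨i, hlt⟩) (o ⟨i, hlt⟩).2.le
        -- At a cut, exactly i openers and i closers precede the opener with index i, which
        -- therefore sits at position 2i.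
        have h4 : ((o ⟨i, hlt⟩ : Fin (2 * n)) : ℕ) = 2 * i := by
          rw [h1, h2, Fin.card_Iio] at h3
          simp only at h3
          omega
        rw [h4] at h1 h2
        rw [h1, h2]
      · simp
  have hset : {i : ℕ | 1 ≤ i ∧ i ≤ n ∧ M.IsBalancedAt i} =
      ((Finset.Icc 1 n).filter fun i => ∀ y < i, e y ≤ i : Finset ℕ) := by
    ext i
    simp only [Finset.coe_filter, Finset.mem_Icc, Set.mem_ofPred_eq, and_assoc]
    exact and_congr_right fun h1 => and_congr_right fun h2 => hbal i h1 h2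
  rw [bl, hset, Set.ncard_coe_finset, cutC_eq_Icc h.valid]

/-- The first closer is that of the first arc. The arcs opened before it form a crossing, and every
crossing through the first arc is contained in this one. -/
theorem Codes.fcr_eq (h : M.Codes o c e) (hc : ClosersSorted c e)
    (ht : TieSorted negCast n e) : M.fcr = minC n e := by
  rcases Nat.eq_zero_or_pos n with rfl | hn
  · simp [fcr, minC]
  classical
  have htie : ∀ x y : Fin n, x < y → (∀ z : Fin n, (x : ℕ) < e z → (y : ℕ) < e z) → e x ≤ e y :=
    fun x y hxy hz =>
      (h.valid.negCast_le_iff _ _).1 (ht x y hxy y.2 fun z hzn hxz => hz ⟨z, hzn⟩ hxz)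
  -- At a minimiser z every value of `e` exceeds z, so 0 and z have empty down-sets and the tie rule
  -- applies.
  have h0min : ∀ x : Fin n, e 0 ≤ e x := by
    intro x
    obtain ⟨z, -, hz⟩ := Finset.exists_min_image Finset.univ (fun x : Fin n => e x) ⟨x, by simp⟩
    refine le_trans ?_ (hz x (Finset.mem_univ x))
    rcases Nat.eq_zero_or_pos z with hz0 | hz0
    · rw [hz0]
    · exact htie ⟨0, hn⟩ z hz0 fun w _ => (h.valid.lt z.2).trans_le (hz w (Finset.mem_univ w))
  let R : Finset (Fin n) := Finset.univ.filter fun y => (y : ℕ) < e 0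
  let S₀ : Finset (Fin (2 * n)) := R.image o
  have ho0 : (o ⟨0, hn⟩ : ℕ) = 0 := by
    rcases h.exists_eq ⟨0, by omega⟩ with ⟨x, hx⟩ | ⟨x, hx⟩
    · have h1 : o ⟨0, hn⟩ ≤ o x := h.strictMono.monotone (Fin.le_def.2 (Nat.zero_le _))
      rw [hx] at h1
      exact Nat.le_zero.1 h1
    · have h1 := h.lt x
      rw [hx] at h1
      exact absurd h1 (Nat.not_lt_zero _)
  have h0R : (⟨0, hn⟩ : Fin n) ∈ R := by
    simpa [R] using h.valid.lt hn
  have hcross : M.IsCrossing S₀ := by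
    refine ⟨⟨_, Finset.mem_image_of_mem o h0R⟩, ?_, ?_⟩
    · intro a ha
      obtain ⟨x, -, rfl⟩ := Finset.mem_image.1 ha
      exact (h.isOpener_iff _).2 ⟨x, rfl⟩
    · intro a ha b hb hab
      obtain ⟨x, hx, rfl⟩ := Finset.mem_image.1 ha
      obtain ⟨y, hy, rfl⟩ := Finset.mem_image.1 hb
      simp only [R, Finset.mem_filter, Finset.mem_univ, true_and] at hx hy
      have hxy : x < y := h.strictMono.lt_iff_lt.1 hab
      rw [h.partner_eq, h.partner_eq, h.lt_iff, h.closer_lt_closer_iff hc]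
      refine ⟨hy.trans_le (h0min x), ?_⟩
      rcases (htie x y hxy fun z _ => hy.trans_le (h0min z)).lt_or_eq with h1 | h1
      · exact Or.inl h1
      · exact Or.inr ⟨h1, hxy⟩
  have hsub : ∀ S, M.IsCrossing S → (∃ a ∈ S, (a : ℕ) = 0) → S ⊆ S₀ := by
    rintro S hS ⟨a, haS, ha0⟩ b hb
    have ha : a = o ⟨0, hn⟩ := Fin.ext (ha0.trans ho0.symm)
    subst ha
    obtain ⟨y, rfl⟩ := (h.isOpener_iff b).1 (hS.2.1 b hb)
    refine Finset.mem_image_of_mem o ?_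
    rcases Nat.eq_zero_or_pos y with hy0 | hy0
    · have : y = ⟨0, hn⟩ := Fin.ext hy0
      rw [this]
      exact h0R
    · have := (hS.2.2 _ haS _ hb (h.strictMono hy0)).1
      rw [h.partner_eq, h.lt_iff] at this
      simpa [R] using this
  have h0S : ∃ a ∈ S₀, (a : ℕ) = 0 := ⟨_, Finset.mem_image_of_mem o h0R, ho0⟩
  have hset : {k | ∃ S, M.IsMaximalCrossing S ∧ (∃ a ∈ S, (a : ℕ) = 0) ∧ S.card = k} =
      {S₀.card} := by
    ext k
    constructor
    · rintro ⟨S, hS, hS0, rfl⟩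
      have h1 := hsub S hS.1 hS0
      rw [Set.mem_singleton_iff, h1.antisymm (hS.2 hcross h1)]
    · rintro rfl
      refine ⟨S₀, ⟨hcross, fun T hT hle => ?_⟩, h0S, rfl⟩
      obtain ⟨a, ha, ha0⟩ := h0S
      exact hsub T hT ⟨a, hle ha, ha0⟩
  rw [fcr, hset, csSup_singleton, Finset.card_image_of_injective _ h.strictMono.injective, minC,
    ← card_subtype_eq_card_filter (Equiv.refl (Fin n)), Nat.card_eq_fintype_card]
  refine (Fintype.card_of_subtype R fun y => ?_).symm
  simp only [R, Finset.mem_filter, Finset.mem_univ, true_and, Equiv.refl_apply]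
  exact ⟨fun hy x hx => hy.trans_le (h0min ⟨x, hx⟩), fun hy => hy 0 hn⟩

/-! #### Patterns -/

/-- The matching patterns prescribe more order than the poset patterns: the arc that closes first
must also open first. Among arcs closing after the opener of d, one with least value of `e` does so;
otherwise the tie rule would give e d ≤ e a' ≤ b. -/
theorem Codes.exists_first_closer (h : M.Codes o c e) (ht : TieSorted negCast n e) {a b d : Fin n}
    (hda : (d : ℕ) < e a) (hab : e a ≤ b) (hbd : (b : ℕ) < e d) :
    ∃ a' : Fin n, a' < d ∧ (d : ℕ) < e a' ∧ e a' ≤ b := by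
  classical
  obtain ⟨a', ha', hmin⟩ := Finset.exists_min_image
    (Finset.univ.filter fun z : Fin n => (d : ℕ) < e z) (fun z => e z) ⟨a, by simpa⟩
  simp only [Finset.mem_filter, Finset.mem_univ, true_and] at ha' hmin
  have hle := hmin a hda
  refine ⟨a', ?_, ha', hle.trans hab⟩
  by_contra! hcon
  rcases hcon.lt_or_eq with hlt | rfl
  · have h1 := (h.valid.negCast_le_iff _ _).1 (ht d a' hlt a'.2 fun z hz hdz =>
      (h.valid.lt a'.2).trans_le (hmin ⟨z, hz⟩ hdz))
    omega
  · omega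

/-- Dually, the arc that opens last must also close last. The last opener before the closer of d,
with index e d - 1, has this property. -/
theorem Codes.exists_last_opener (h : M.Codes o c e) (hc : ClosersSorted c e) {b d : Fin n}
    (hbd : (b : ℕ) < e d) (hdb : (d : ℕ) < b) :
    ∃ b' : Fin n, b ≤ b' ∧ o b' < c d ∧ c d < c b' := by
  have hn := h.valid.le d
  refine ⟨⟨e d - 1, by omega⟩, Fin.le_def.2 (by simp only; omega), (h.lt_iff _ _).2 ?_,
    (h.closer_lt_closer_iff hc _ _).2 ?_⟩
  · simp only
    omega
  · have h1 := h.valid.lt (show e d - 1 < n by omega)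
    simp only [Fin.lt_def]
    omega

theorem Codes.exists_arc_of_embedding (h : M.Codes o c e) {k : ℕ} {P : Matching k}
    {f : Fin (2 * k) ↪o Fin (2 * n)} (hf : ∀ i, M.partner (f i) = f (P.partner i))
    (i : Fin (2 * k)) (hi : i < P.partner i) :
    ∃ x, o x = f i ∧ c x = f (P.partner i) :=
  h.exists_arc ⟨f.lt_iff_lt.2 hi, hf i⟩

/-- For the converse, the minimum of the 3-chain is moved to an early opener and its maximum to a
late one; the middle element and the isolated point stay. -/
theorem Codes.contains_patternOne_iff (h : M.Codes o c e) (hc : ClosersSorted c e)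
    (ht : TieSorted negCast n e) : M.Contains patternOne ↔ HasThreePlusOne n e := by
  constructor
  · rintro ⟨f, hf⟩
    obtain ⟨a, ha1, ha2⟩ := h.exists_arc_of_embedding hf 0 (by decide)
    obtain ⟨d, hd1, hd2⟩ := h.exists_arc_of_embedding hf 1 (by decide)
    obtain ⟨b, hb1, hb2⟩ := h.exists_arc_of_embedding hf 3 (by decide)
    obtain ⟨s, hs1, hs2⟩ := h.exists_arc_of_embedding hf 5 (by decide)
    refine ⟨a, b, s, d, b.2, s.2, ?_, ?_, ?_, ?_, d.2⟩
    · rw [← h.lt_iff, hd1, ha2, f.lt_iff_lt]; decide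
    · rw [← h.closer_lt_iff, ha2, hb1, f.lt_iff_lt]; decide
    · rw [← h.closer_lt_iff, hb2, hs1, f.lt_iff_lt]; decide
    · rw [← h.lt_iff, hs1, hd2, f.lt_iff_lt]; decide
  · rintro ⟨a, b, s, d, hb, hs, h1, h2, h3, h4, hd⟩
    have ha : a < n := by
      by_contra ha
      rw [h.valid.2 a (by omega)] at h1
      omega
    have hbb := h.valid.lt hb
    obtain ⟨a', h5, h6, h7⟩ := h.exists_first_closer ht (a := ⟨a, ha⟩) (b := ⟨b, hb⟩) (d := ⟨d, hd⟩)
      h1 h2 (by simp only; omega)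
    obtain ⟨s', h8, h9, h10⟩ := h.exists_last_opener hc (b := ⟨s, hs⟩) (d := ⟨d, hd⟩) h4
      (by simp only; omega)
    have h11 : e b ≤ s' := h3.trans h8
    have l1 := h.strictMono h5
    have l2 := (h.lt_iff a' ⟨d, hd⟩).2 h6
    have l3 := (h.closer_lt_iff a' ⟨b, hb⟩).2 h7
    have l4 := h.lt ⟨b, hb⟩
    have l5 := (h.closer_lt_iff ⟨b, hb⟩ s').2 h11
    have hm : StrictMono ![o a', o ⟨d, hd⟩, c a', o ⟨b, hb⟩, c ⟨b, hb⟩, o s', c ⟨d, hd⟩, c s'] := by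
      refine Fin.strictMono_iff_lt_succ.2 fun i => ?_
      fin_cases i <;> assumption
    refine ⟨OrderEmbedding.ofStrictMono _ hm, fun i => ?_⟩
    fin_cases i <;> first | exact h.partner_eq _ | exact h.partner_closer _

theorem Codes.contains_patternTwo_iff (h : M.Codes o c e) (hc : ClosersSorted c e)
    (ht : TieSorted negCast n e) : M.Contains patternTwo ↔ HasN n e := by
  constructor
  · rintro ⟨f, hf⟩
    obtain ⟨a, ha1, ha2⟩ := h.exists_arc_of_embedding hf 0 (by decide)
    obtain ⟨b, hb1, hb2⟩ := h.exists_arc_of_embedding hf 1 (by decide)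
    obtain ⟨s, hs1, hs2⟩ := h.exists_arc_of_embedding hf 3 (by decide)
    obtain ⟨d, hd1, hd2⟩ := h.exists_arc_of_embedding hf 5 (by decide)
    refine ⟨a, b, s, d, d.2, ?_, ?_, ?_, ?_, ?_⟩
    · rw [← h.lt_iff, hb1, ha2, f.lt_iff_lt]; decide
    · rw [← h.closer_lt_iff, ha2, hs1, f.lt_iff_lt]; decide
    · rw [← h.lt_iff, hs1, hb2, f.lt_iff_lt]; decide
    · rw [← h.closer_lt_iff, hb2, hd1, f.lt_iff_lt]; decide
    · rw [← h.lt_iff, hd1, hs2, f.lt_iff_lt]; decide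
  · rintro ⟨a, b, s, d, hd, h1, h2, h3, h4, h5⟩
    have hs : s < n := by
      have := h.valid.le b
      omega
    have hb : b < n := by omega
    have ha : a < n := by
      by_contra ha
      rw [h.valid.2 a (by omega)] at h1
      omega
    obtain ⟨a', h6, h7, h8⟩ := h.exists_first_closer ht (a := ⟨a, ha⟩) (b := ⟨s, hs⟩) (d := ⟨b, hb⟩)
      h1 h2 h3
    obtain ⟨d', h9, h10, h11⟩ := h.exists_last_opener hc (b := ⟨d, hd⟩) (d := ⟨s, hs⟩) h5
      (by simp only; omega)
    have h12 : e b ≤ d' := h4.trans h9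
    have l1 := h.strictMono h6
    have l2 := (h.lt_iff a' ⟨b, hb⟩).2 h7
    have l3 := (h.closer_lt_iff a' ⟨s, hs⟩).2 h8
    have l4 := (h.lt_iff ⟨b, hb⟩ ⟨s, hs⟩).2 h3
    have l5 := (h.closer_lt_iff ⟨b, hb⟩ d').2 h12
    have hm : StrictMono ![o a', o ⟨b, hb⟩, c a', o ⟨s, hs⟩, c ⟨b, hb⟩, o d', c ⟨s, hs⟩, c d'] := by
      refine Fin.strictMono_iff_lt_succ.2 fun i => ?_
      fin_cases i <;> assumption
    refine ⟨OrderEmbedding.ofStrictMono _ hm, fun i => ?_⟩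
    fin_cases i <;> first | exact h.partner_eq _ | exact h.partner_closer _

end

end Matching

/-! ### Generating functions of the two classes of matchings -/

theorem genMatching_eq {k : ℕ} {Q : Matching k} {H P : ℕ → (ℕ → ℕ) → Prop}
    [∀ n, Finite {e // P n e}]
    (hP : ∀ n e, P n e ↔ Valid n e ∧ TieSorted negCast n e ∧ ¬ H n e)
    (hH : ∀ (n : ℕ) (M : Matching n) o c e, M.Codes o c e → Matching.ClosersSorted c e →
      TieSorted negCast n e → (M.Contains Q ↔ H n e)) :
    genMatching Q =
      genFun (fun n => {e // P n e}) (fun n e => minC n e.1) (fun n e => cutC n e.1) := by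
  choose M o c hM hc using fun n (e : {e // P n e}) => Matching.exists_of_valid ((hP n e.1).1 e.2).1
  have ht : ∀ n (e : {e // P n e}), TieSorted negCast n e.1 := fun n e => ((hP n e.1).1 e.2).2.1
  have hSt : ∀ n (e : {e // P n e}), (M n e).IsStoimenow := fun n e =>
    (hM n e).isStoimenow (hc n e) (ht n e)
  refine (genFun_congr (T := fun n => {e // P n e}) (S := StoimenowAvoiding Q)
    (fun n e => ⟨M n e, hSt n e,
      (hH n _ _ _ _ (hM n e) (hc n e) (ht n e)).not.2 ((hP n e.1).1 e.2).2.2⟩)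
    (fun n => ⟨?_, ?_⟩) (fun n e => (hM n e).fcr_eq (hc n e) (ht n e))
    fun n e => (hM n e).bl_eq).symm
  · intro e e' h
    have h0 : M n e = M n e' := congrArg Subtype.val h
    have h1 := hM n e
    rw [h0] at h1
    exact Subtype.ext (h1.code_eq (hM n e'))
  · rintro ⟨M', hM', hQ⟩
    obtain ⟨o', c', e, he⟩ := M'.exists_codes
    have ht' := he.tieSorted hM'
    refine ⟨⟨e, (hP n e).2 ⟨he.valid, ht', ?_⟩⟩, Subtype.ext ((hM n _).eq_matching (hSt n _) he hM')⟩
    exact (hH n _ _ _ _ he (he.closersSorted hM') ht').not.1 hQ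

theorem genMatching_patternOne_eq : genMatching Matching.patternOne =
    genFun (fun n => {e // IsMono n e}) (fun n e => minC n e.1) (fun n e => cutC n e.1) :=
  genMatching_eq (fun _ _ => isMono_iff) fun _ _ _ _ _ h => h.contains_patternOne_iff

theorem genMatching_patternTwo_eq : genMatching Matching.patternTwo =
    genFun (fun n => {e // IsSortedNFree n e}) (fun n e => minC n e.1) (fun n e => cutC n e.1) :=
  genMatching_eq (fun _ _ => Iff.rfl) fun _ _ _ _ _ h => h.contains_patternTwo_iff

end Fishburn

theorem mainTheorem5 :
    Fishburn.genMatching Fishburn.Matching.patternOne =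
        Fishburn.genMatching Fishburn.Matching.patternTwo ∧
    Fishburn.genMatching Fishburn.Matching.patternTwo = Fishburn.genPosetThreePlusOne ∧
    Fishburn.genPosetThreePlusOne = Fishburn.genPosetN ∧
    Fishburn.genPosetN = Fishburn.genAscent ∧
    Fishburn.genAscent = Fishburn.genFishburn ∧
    -- the first closed form, as an identity in the field of fractions
    (let y := Fishburn.toFrac Fishburn.serY
     let z := Fishburn.toFrac Fishburn.serZ
     let t := Fishburn.toFrac Fishburn.serT
     let s := Fishburn.toFrac Fishburn.sqrtSeries
     (2 * t - y * t * (1 - s)) * (2 * t - z * t * (1 - s)) ≠ 0 ∧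
     Fishburn.toFrac Fishburn.genFishburn =
       1 + (4 * t ^ 2 * y * z * t) /
         ((2 * t - y * t * (1 - s)) * (2 * t - z * t * (1 - s)))) ∧
    -- the second closed form
    Fishburn.genFishburn =
      1 + Fishburn.serY * Fishburn.serZ * Fishburn.serT *
        Fishburn.ballotGF Fishburn.varY * Fishburn.ballotGF Fishburn.varZ ∧
    -- the coefficients of the two factors are the ballot numbers
    (∀ x : Fishburn.Coeffs,
      Fishburn.ballotGF x =
        1 + Fishburn.serT * PowerSeries.mk fun n =>
          ∑ k ∈ Finset.range (n + 1),
            MvPolynomial.C (Fishburn.ballotNumber n k) * x ^ (n + 1 - k)) ∧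
    -- the distribution is symmetric in `y` and `z`
    Fishburn.swapYZ (Fishburn.genMatching Fishburn.Matching.patternOne) =
        Fishburn.genMatching Fishburn.Matching.patternOne ∧
    Fishburn.swapYZ (Fishburn.genMatching Fishburn.Matching.patternTwo) =
        Fishburn.genMatching Fishburn.Matching.patternTwo := by
  have h1 := Fishburn.isCatalanPair_isMono.genFun_eq
  have h2 := Fishburn.isCatalanPair_isNoncrossing.genFun_eq
  have h3 := Fishburn.isCatalanPair_isRGF.genFun_eq
  have m1 := Fishburn.genMatching_patternOne_eq.trans h1
  -- The change of tie order enters here: the codes of these matchings are not noncrossing in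
  -- general.
  have m2 := Fishburn.genMatching_patternTwo_eq.trans (Fishburn.genFun_isSortedNFree.trans h2)
  have p1 := Fishburn.genPosetThreePlusOne_eq.trans h1
  have p2 := Fishburn.genPosetN_eq.trans h2
  have a := Fishburn.genAscent_eq.trans h3
  have f := Fishburn.genFishburn_eq.trans h2
  refine ⟨m1.trans m2.symm, m2.trans p1.symm, p1.trans p2.symm, p2.trans a.symm, a.trans f.symm,
    Fishburn.closedForm f, f, Fishburn.ballotGF_eq, ?_, ?_⟩
  · rw [m1, Fishburn.swapYZ_closedForm]
  · rw [m2, Fishburn.swapYZ_closedForm]
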